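/- \textbf{Setting.} For $k\in\mathbb N$ let $\mathrm{Prop}_k$ be the finite set consisting of the special propositions $\mathit{call},\mathit{ret},\mathit{int}$ and $k$ further propositions. Let $\Sigma_k$ be the set of all $P\subseteq \mathrm{Prop}_k$ containing exactly one special proposition; $P$ is a call, a return or an internal action according to which one it contains. A finite timed word over $\Sigma_k$ is a pair $w=(\sigma,\tau)$ where $\sigma\in\Sigma_k^*$ and $\tau_0\le\tau_1\le\dots$ are non-negative reals, one for each position of $\sigma$. Well-matched words over $\Sigma_k$ are given by $u::=\varepsilon\mid a\,u\mid c\,u\,r\,u$ ($a$ internal action, $c$ call, $r$ return). The matching return of a call position $i$ of $\sigma$ is the return position $j>i$, if any, such that the factor of $\sigma$ strictly between $i$ and $j$ is well-matched. The abstract successor of a call position is its matching return, if any; the abstract successor of a non-call position $i$ is $i+1$, if this is a position of $\sigma$ and is not a return. A maximal abstract path is a maximal sequence of positions in which each position is the abstract successor of the preceding one; each position $i$ lies on exactly one, whose set of positions is denoted by $\mathrm{Pos}(\mathrm{a},\sigma,i)$. Let $\mathrm{Pos}(\mathrm{g},\sigma,i)$ be the set of all positions of $\sigma$. Formulas of \emph{future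 NMTL} (future MTL extended with the abstract timed until) over $\mathrm{Prop}_k$ are $$\varphi::=\top\mid p\mid\varphi\vee\varphi\mid\neg\varphi\mid\varphi\,\mathsf U^{\mathrm g}_I\,\varphi\mid\varphi\,\mathsf U^{\mathrm a}_I\,\varphi,$$ where $p\in\mathrm{Prop}_k$ and $I$ is a non-empty interval (open, closed or half-open, bounded or unbounded) in $[0,\infty)$ with endpoints in $\mathbb N\cup\{\infty\}$. For a position $i$ of $w$, $(w,i)\models p$ iff $p\in\sigma_i$, the Boolean connectives are as usual, and $(w,i)\models\varphi_1\,\mathsf U^{d}_I\,\varphi_2$ iff there is $j>i$ in $\mathrm{Pos}(d,\sigma,i)$ with $(w,j)\models\varphi_2$ and $\tau_j-\tau_i\in I$ such that $(w,l)\models\varphi_1$ for all $l\in\mathrm{Pos}(d,\sigma,i)$ with $i<l<j$. A formula is satisfiable over finite timed words if $(w,0)\models\varphi$ for some non-empty finite timed word $w$ over $\Sigma_k$. The abstract next modality is $\bigcirc^{\mathrm a}\psi:=(\neg\top)\,\mathsf U^{\mathrm a}_{[0,\infty)}\,\psi$. \textbf{Theorem.} Satisfiability of future NMTL over finite timed words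 is undecidable: there is no algorithm that, given $k$ and a future NMTL formula over $\mathrm{Prop}_k$, decides whether the formula is satisfiable over finite timed words. This remains true when the input is restricted to formulas in which the abstract until occurs only in the form of the abstract next modality $\bigcirc^{\mathrm a}$. -/

import Mathlib

open scoped NNReal

namespace NMTL

/-! ### Propositions, letters and finite timed words -/

/-- A finite set of atomic propositions containing the three special propositions `call`, `ret`
and `intA`, together with `k` further propositions. -/
inductive AP (k : ℕ) where
  | call : AP k
  | ret : AP k
  | intA : AP k
  | user : Fin k → AP k

/-- `P` is a call. -/
def IsCall {k : ℕ} (P : Set (AP k)) : Prop := P ∩ {AP.call, AP.ret, AP.intA} = {AP.call}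

/-- `P` is a return. -/
def IsRet {k : ℕ} (P : Set (AP k)) : Prop := P ∩ {AP.call, AP.ret, AP.intA} = {AP.ret}

/-- `P` is an internal action. -/
def IsInt {k : ℕ} (P : Set (AP k)) : Prop := P ∩ {AP.call, AP.ret, AP.intA} = {AP.intA}

/-- The pushdown alphabet induced by the set of propositions `AP k`. -/
def Letter (k : ℕ) : Type := {P : Set (AP k) // IsCall P ∨ IsRet P ∨ IsInt P}

/-- A finite timed word over the pushdown alphabet: an untimed word with a monotone sequence of
non-negative real timestamps, one for each position. -/
structure TimedWord (k : ℕ) where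
  letters : List (Letter k)
  time : Fin letters.length → ℝ≥0
  mono : Monotone time

/-! ### Matching returns, abstract paths and caller paths -/

/-- Well-matched words over the pushdown alphabet. -/
inductive WellMatched {k : ℕ} : List (Letter k) → Prop
  | nil : WellMatched []
  | internal (a : Letter k) (w : List (Letter k)) :
      IsInt a.1 → WellMatched w → WellMatched (a :: w)
  | matched (c r : Letter k) (w w' : List (Letter k)) :
      IsCall c.1 → IsRet r.1 → WellMatched w → WellMatched w' →
      WellMatched (c :: (w ++ r :: w'))

section Paths

variable {k : ℕ} (σ : List (Letter k))

/-- `j` is the matching return of the call position `i`: the factor of `σ` strictly between `i`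
and `j` is well-matched. -/
def MatchingReturn (i j : Fin σ.length) : Prop :=
  IsCall (σ.get i).1 ∧ IsRet (σ.get j).1 ∧ i < j ∧
    WellMatched ((σ.take j).drop (i + 1))

/-- `j` is the abstract successor of `i` along `σ`. -/
def AbsSucc (i j : Fin σ.length) : Prop :=
  (IsCall (σ.get i).1 → MatchingReturn σ i j) ∧
    (¬ IsCall (σ.get i).1 → (j : ℕ) = i + 1 ∧ ¬ IsRet (σ.get j).1)

/-- `j` is a call position before `i` whose abstract successor is undefined or after `i`. -/
def PendingCall (i j : Fin σ.length) : Prop :=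
  j < i ∧ IsCall (σ.get j).1 ∧ ∀ m, AbsSucc σ j m → i < m

/-- `j` is the caller of `i` along `σ`. -/
def Caller (i j : Fin σ.length) : Prop := IsGreatest {j | PendingCall σ i j} j

/-- The positions visited by the maximal abstract path through `i`. Each position has at most one
abstract successor and is the abstract successor of at most one position, so this path consists
of the positions reachable from `i`, and those from which `i` is reachable, by iterating the
abstract successor. -/
def absPos (i : Fin σ.length) : Set (Fin σ.length) :=
  {j | Relation.ReflTransGen (AbsSucc σ) i j ∨ Relation.ReflTransGen (AbsSucc σ) j i}

/-- The positions visited by the caller path from `i`. -/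
def callerPos (i : Fin σ.length) : Set (Fin σ.length) :=
  {j | Relation.ReflTransGen (Caller σ) i j}

end Paths

/-! ### Syntax -/

/-- Non-empty intervals in the non-negative reals with endpoints in `ℕ ∪ {∞}`. The flags say
whether the endpoint belongs to the interval; `hi = none` stands for the endpoint `∞`. -/
structure Interval where
  lo : ℕ
  loClosed : Bool
  hi : Option (ℕ × Bool)
  nonempty : ∀ u ∈ hi, lo < u.1 ∨ (lo = u.1 ∧ loClosed = true ∧ u.2 = true)

/-- The set of reals denoted by an interval. -/
def Interval.toSet (I : Interval) : Set ℝ :=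
  {x | (if I.loClosed then (I.lo : ℝ) ≤ x else (I.lo : ℝ) < x) ∧
    ∀ u ∈ I.hi, if u.2 then x ≤ (u.1 : ℝ) else x < (u.1 : ℝ)}

/-- The interval `[0, ∞)`. -/
def Interval.univ : Interval := ⟨0, true, none, by simp⟩

/-- Directions of the until modalities: global and abstract. -/
inductive FDir where
  | glob : FDir
  | abs : FDir

/-- Directions of the since modalities: global, abstract and caller. -/
inductive PDir where
  | glob : PDir
  | abs : PDir
  | caller : PDir

/-- Formulas of nested metric temporal logic over the propositions `AP k`. The formula
`untl d I φ ψ` is `φ U ψ` and `snce d I φ ψ` is `φ S ψ`, with direction `d` and interval `I`. -/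
inductive Formula (k : ℕ) where
  | top : Formula k
  | atom : AP k → Formula k
  | or : Formula k → Formula k → Formula k
  | neg : Formula k → Formula k
  | untl : FDir → Interval → Formula k → Formula k → Formula k
  | snce : PDir → Interval → Formula k → Formula k → Formula k

/-- Future formulas: those without since modalities. -/
def Formula.IsFuture {k : ℕ} : Formula k → Prop
  | .top => True
  | .atom _ => True
  | .or φ ψ => φ.IsFuture ∧ ψ.IsFuture
  | .neg φ => φ.IsFuture
  | .untl _ _ φ ψ => φ.IsFuture ∧ ψ.IsFuture
  | .snce _ _ _ _ => False

/-- Future formulas in which abstract modalities occur only in the form of the abstract next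
`⊥ U ψ`, with direction `abs` and the interval `[0, ∞)`. -/
def Formula.IsFutureAbsNext {k : ℕ} : Formula k → Prop
  | .top => True
  | .atom _ => True
  | .or φ ψ => φ.IsFutureAbsNext ∧ ψ.IsFutureAbsNext
  | .neg φ => φ.IsFutureAbsNext
  | .untl .glob _ φ ψ => φ.IsFutureAbsNext ∧ ψ.IsFutureAbsNext
  | .untl .abs I φ ψ => I = Interval.univ ∧ φ = .neg .top ∧ ψ.IsFutureAbsNext
  | .snce _ _ _ _ => False

/-! ### Pointwise semantics over finite timed words -/

/-- The positions that an until modality at `i` refers to. -/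
def FDir.pos {k : ℕ} (σ : List (Letter k)) (i : Fin σ.length) : FDir → Set (Fin σ.length)
  | .glob => Set.univ
  | .abs => absPos σ i

/-- The positions that a since modality at `i` refers to. -/
def PDir.pos {k : ℕ} (σ : List (Letter k)) (i : Fin σ.length) : PDir → Set (Fin σ.length)
  | .glob => Set.univ
  | .abs => absPos σ i
  | .caller => callerPos σ i

/-- The satisfaction relation `(w, i) ⊨ φ`. -/
def Holds {k : ℕ} (w : TimedWord k) : Fin w.letters.length → Formula k → Prop
  | _, .top => True
  | i, .atom p => p ∈ (w.letters.get i).1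
  | i, .or φ ψ => Holds w i φ ∨ Holds w i ψ
  | i, .neg φ => ¬ Holds w i φ
  | i, .untl d I φ ψ =>
      ∃ j, i < j ∧ j ∈ d.pos w.letters i ∧ Holds w j ψ ∧
        ((w.time j : ℝ) - (w.time i : ℝ)) ∈ I.toSet ∧
        ∀ l, i < l → l < j → l ∈ d.pos w.letters i → Holds w l φ
  | i, .snce d I φ ψ =>
      ∃ j, j < i ∧ j ∈ d.pos w.letters i ∧ Holds w j ψ ∧
        ((w.time i : ℝ) - (w.time j : ℝ)) ∈ I.toSet ∧
        ∀ l, j < l → l < i → l ∈ d.pos w.letters i → Holds w l φ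

/-- `φ` has a finite model: a finite timed word satisfying `φ` at its first position. -/
def Formula.Satisfiable {k : ℕ} (φ : Formula k) : Prop :=
  ∃ (w : TimedWord k) (h : 0 < w.letters.length), Holds w ⟨0, h⟩ φ

/-! ### Effective coding of formulas, and decidability -/

/-- Codes of propositions. -/
def AP.code {k : ℕ} : AP k → ℕ
  | .call => 0
  | .ret => 1
  | .intA => 2
  | .user i => i + 3

/-- Codes of intervals. -/
def Interval.code (I : Interval) : ℕ := Encodable.encode ((I.lo, I.loClosed), I.hi)

/-- Codes of directions. -/
def FDir.code : FDir → ℕ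
  | .glob => 0
  | .abs => 1

/-- Codes of directions. -/
def PDir.code : PDir → ℕ
  | .glob => 0
  | .abs => 1
  | .caller => 2

/-- The code of a formula: its syntax tree written as a natural number. -/
def Formula.code {k : ℕ} : Formula k → ℕ
  | .top => Nat.pair 0 0
  | .atom p => Nat.pair 1 p.code
  | .or φ ψ => Nat.pair 2 (Nat.pair φ.code ψ.code)
  | .neg φ => Nat.pair 3 φ.code
  | .untl d I φ ψ => Nat.pair 4 (Nat.pair (Nat.pair d.code I.code) (Nat.pair φ.code ψ.code))
  | .snce d I φ ψ => Nat.pair 5 (Nat.pair (Nat.pair d.code I.code) (Nat.pair φ.code ψ.code))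

theorem AP.code_injective {k : ℕ} : Function.Injective (AP.code (k := k)) := by
  intro p q h
  cases p <;> cases q <;> simp [AP.code, Fin.ext_iff] at h ⊢; omega

theorem Interval.code_injective : Function.Injective Interval.code := by
  rintro ⟨a, b, c, _⟩ ⟨a', b', c', _⟩ h
  have h' := Encodable.encode_injective h
  simp_all

theorem FDir.code_injective : Function.Injective FDir.code := by
  intro p q h
  cases p <;> cases q <;> simp [FDir.code] at h ⊢

theorem PDir.code_injective : Function.Injective PDir.code := by
  intro p q h
  cases p <;> cases q <;> simp [PDir.code] at h ⊢

/-- A formula over `AP k` is determined by its code. -/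
theorem Formula.code_injective {k : ℕ} : Function.Injective (Formula.code (k := k)) := by
  intro φ
  induction φ with
  | top => intro ψ h; cases ψ <;> simp [Formula.code, Nat.pair_eq_pair] at h ⊢
  | atom p =>
    intro ψ h
    cases ψ <;> simp [Formula.code, Nat.pair_eq_pair] at h ⊢
    exact AP.code_injective h
  | or a b iha ihb =>
    intro ψ h
    cases ψ <;> simp [Formula.code, Nat.pair_eq_pair] at h ⊢
    exact ⟨iha h.1, ihb h.2⟩
  | neg a iha =>
    intro ψ h
    cases ψ <;> simp [Formula.code, Nat.pair_eq_pair] at h ⊢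
    exact iha h
  | untl d I a b iha ihb =>
    intro ψ h
    cases ψ <;> simp [Formula.code, Nat.pair_eq_pair] at h ⊢
    exact ⟨FDir.code_injective h.1.1, Interval.code_injective h.1.2, iha h.2.1, ihb h.2.2⟩
  | snce d I a b iha ihb =>
    intro ψ h
    cases ψ <;> simp [Formula.code, Nat.pair_eq_pair] at h ⊢
    exact ⟨PDir.code_injective h.1.1, Interval.code_injective h.1.2, iha h.2.1, ihb h.2.2⟩

/-- Satisfiability over finite timed words is decidable for the class `C` of formulas: there is a
total computable function that, given the number `k` of propositions besides `call`, `ret`, `intA`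
and the code of a formula over `AP k` in `C`, answers correctly whether the formula has a finite
model. Nothing is required on inputs that are not codes of formulas in `C`. -/
def SatisfiabilityDecidable (C : ∀ k : ℕ, Formula k → Prop) : Prop :=
  ∃ f : ℕ → ℕ → Bool, Computable₂ f ∧
    ∀ (k : ℕ) (φ : Formula k), C k φ → (f k φ.code = true ↔ φ.Satisfiable)

end NMTL

/-! The halting problem of a fixed universal Turing machine is reduced to satisfiability. A
configuration is written as a word with a border letter in front, and a machine step becomes a
length-preserving rewriting step on a window of three letters. A computation is then a helix: rows
of some length `L` written one after another, where tile `p + L` is determined by tile `p`. A tile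
records a letter and the place of a rule, if any, that is applied there, so a row determines its
successor tile by tile and adjacency of tiles keeps the three places of a rule together.

To check a helix, a formula must compare positions that differ by the unknown number `L`. The
comparison uses time: a row lasts one time unit, and the global until with interval `[1, 1]` reaches
the copy one unit later. A future formula can say that every position outside the last row has a
position exactly one unit later, but by global modalities alone it cannot forbid extra positions
that are copies of nothing.

The abstract next modality removes these extra positions by counting. The word has its calls in an
initial block and its returns in a final block, and the matching return of the first position is the
last position. Hence there are as many returns as calls, say `L` of each, in a word of length `N`.
Times increase strictly, and each of the `N - L` positions that are not returns has a position one
unit later among the `N - L` positions that are not calls. A strictly increasing map between these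
intervals is the shift by `L` (`eq_add_of_strictMono`), so distance one in time is exactly distance
`L` in the word (`exists_carries`). One use of the abstract next therefore suffices.

Conversely a halting run gives a helix (`exists_isHelix`), realised with equidistant times
(`carrier`). The amount of blank tape is chosen by the model, so the number of propositions is fixed
and the formula depends on the input only through a fold over its symbols, which makes the reduction
primitive recursive (`haltingFormula_code_primrec`). -/

namespace NMTL

/-! ### A universal Turing machine over finite types -/

section Machine

open Turing

/-- Restricting a Turing machine to a finite set of states that supports it. -/
theorem exists_fintype_machine {Γ Λ : Type} [Inhabited Γ] [Inhabited Λ] (M : TM0.Machine Γ Λ)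
    (S : Finset Λ) (hS : TM0.Supports M (S : Set Λ)) :
    ∃ (Λ' : Type) (_ : Inhabited Λ') (_ : Finite Λ') (M' : TM0.Machine Γ Λ'), ∀ l,
      (StateTransition.eval (TM0.step M') (TM0.init l)).Dom ↔ (TM0.eval M l).Dom := by
  classical
  let _ : Inhabited S := ⟨⟨default, hS.1⟩⟩
  -- A retraction onto `S`. Its value outside `S` is irrelevant, as the run never leaves `S`.
  let g₁ : PointedMap Λ S :=
    ⟨fun q => if h : q ∈ S then ⟨q, h⟩ else default, by
      have h : (default : Λ) ∈ S := hS.1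
      simp [h]; rfl⟩
  let i : PointedMap Γ Γ := ⟨id, rfl⟩
  refine ⟨S, inferInstance, inferInstance, M.map i i g₁ Subtype.val, fun l => ?_⟩
  have hr := TM0.Machine.map_respects M i i g₁ Subtype.val hS (fun _ => rfl)
    (fun q hq => by
      have hq : q ∈ S := hq
      change ((if h : q ∈ S then (⟨q, h⟩ : S) else default : S) : Λ) = q
      simp [hq])
  have h := StateTransition.tr_eval_dom hr (a₁ := TM0.init l)
    (a₂ := TM0.init (l.map i)) ⟨hS.1, TM0.map_init _ _ _⟩
  have hi : l.map i = l := List.map_id l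
  rw [hi] at h
  exact h

/-! ### Primitive recursive input tapes -/

/-- The binary digits of a number, least significant first. -/
def binDigits : ℕ → List Bool
  | 0 => []
  | n + 1 => (((n + 1) % 2 == 1)) :: binDigits ((n + 1) / 2)
decreasing_by omega

theorem binDigits_primrec : Primrec binDigits := by
  have : Primrec₂ (fun (_ : Unit) n => binDigits n) := by
    -- `L` lists the values at all smaller numbers, so `L.length` is the argument itself and the
    -- entry at `L.length / 2` is the recursive call.
    refine Primrec.nat_strong_rec _
      (g := fun _ L => if L.length = 0 then some [] else
        (L[L.length / 2]?).map (fun r => (L.length % 2 == 1) :: r)) ?_ ?_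
    · have hl : Primrec (fun p : Unit × List (List Bool) => p.2.length) :=
        Primrec.list_length.comp Primrec.snd
      refine Primrec.ite (Primrec.eq.comp hl (Primrec.const 0)) (Primrec.const _) ?_
      refine Primrec.option_map (Primrec.list_getElem?.comp Primrec.snd
        (Primrec.nat_div.comp hl (Primrec.const 2))) ?_
      refine Primrec.list_cons.comp ?_ Primrec.snd
      exact Primrec.beq.comp (Primrec.nat_mod.comp (hl.comp Primrec.fst) (Primrec.const 2))
        (Primrec.const 1)
    · intro _ n
      cases n with
      | zero => simp [binDigits]
      | succ n =>
        have : (n + 1) / 2 < n + 1 := by omega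
        simp only [List.length_map, List.length_range, List.getElem?_map,
          List.getElem?_range this]
        simp [binDigits]
  exact this.comp (Primrec.const ()) Primrec.id

/-- Replaces the encoding by recursion on binary numerals with `binDigits`, which is known to be
primitive recursive. -/
theorem trNat_eq_map_binDigits (n : ℕ) :
    PartrecToTM2.trNat n =
      (binDigits n).map (fun b => if b then PartrecToTM2.Γ'.bit1 else PartrecToTM2.Γ'.bit0) := by
  have key : ∀ p : PosNum, PartrecToTM2.trPosNum p = (binDigits (p : ℕ)).map
      (fun b => if b then PartrecToTM2.Γ'.bit1 else PartrecToTM2.Γ'.bit0) := by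
    have step : ∀ m : ℕ, 0 < m → binDigits m = (m % 2 == 1) :: binDigits (m / 2) := by
      intro m hm
      obtain ⟨m, rfl⟩ : ∃ m', m = m' + 1 := ⟨m - 1, by omega⟩
      rw [binDigits]
    intro p
    induction p with
    | one => simp [PartrecToTM2.trPosNum, step 1 one_pos, binDigits]
    | bit1 p ih =>
      have hp := p.cast_pos (α := ℕ)
      rw [PosNum.cast_bit1, step _ (by omega), PartrecToTM2.trPosNum, ih]
      have h1 : ((p : ℕ) + p + 1) % 2 = 1 := by omega
      have h2 : ((p : ℕ) + p + 1) / 2 = p := by omega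
      simp [h1, h2]
    | bit0 p ih =>
      have hp := p.cast_pos (α := ℕ)
      rw [PosNum.cast_bit0, step _ (by omega), PartrecToTM2.trPosNum, ih]
      have h1 : ((p : ℕ) + p) % 2 = 0 := by omega
      have h2 : ((p : ℕ) + p) / 2 = p := by omega
      simp [h1, h2]
  rw [PartrecToTM2.trNat]
  rcases h : (n : Num) with _ | p
  · have : n = 0 := by
      have := congrArg (fun m : Num => (m : ℕ)) h
      simpa using this
    subst this
    simp [PartrecToTM2.trNum, binDigits]
  · have : n = (p : ℕ) := by
      have := congrArg (fun m : Num => (m : ℕ)) h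
      simpa using this
    rw [PartrecToTM2.trNum, key, this]

/-- The tape on which the universal machine receives the number `n`. -/
def inputTape (n : ℕ) : List (TM2to1.Γ' PartrecToTM2.K' fun _ => PartrecToTM2.Γ') :=
  TM2to1.trInit PartrecToTM2.K'.main (PartrecToTM2.trList [n])

/-- Tape symbols carry no chosen numbering, so computability of the tape is expressed through an
arbitrary map of symbols to numbers. -/
theorem inputTape_map_primrec
    (e : (TM2to1.Γ' PartrecToTM2.K' fun _ => PartrecToTM2.Γ') → ℕ) :
    Primrec fun n => (inputTape n).map e := by
  classical
  let h : Bool → ℕ := fun b => e (false, Function.update (fun _ => none) PartrecToTM2.K'.main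
    (some (if b then PartrecToTM2.Γ'.bit1 else PartrecToTM2.Γ'.bit0)))
  -- The tape holds the reversed list, so the terminator `cons` comes first; only this cell has the
  -- mark `true`, for the bottom of the stack.
  let e₀ := e (true, Function.update (fun _ => none) PartrecToTM2.K'.main
    (some PartrecToTM2.Γ'.cons))
  have : ∀ n, e₀ :: (binDigits n).reverse.map h = (inputTape n).map e := by
    intro n
    simp only [inputTape, PartrecToTM2.trList, trNat_eq_map_binDigits, TM2to1.trInit,
      List.reverse_append]
    simp only [← List.map_reverse, List.reverse_cons, List.reverse_nil, List.nil_append,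
      List.singleton_append]
    refine congrArg (e₀ :: ·) ?_
    induction (binDigits n).reverse with
    | nil => rfl
    | cons b l ih => exact congrArg (h b :: ·) ih
  refine Primrec.of_eq ?_ this
  refine Primrec.list_cons.comp (Primrec.const _) ?_
  exact Primrec.list_map (Primrec.list_reverse.comp binDigits_primrec)
    ((Primrec.dom_finite h).comp Primrec.snd)

/-- There is a Turing machine with finitely many symbols and states whose halting problem is
undecidable, for input tapes that are computed from natural numbers. -/
theorem exists_universal_machine :
    ∃ (Γ Λ : Type) (_ : Inhabited Γ) (_ : Inhabited Λ) (_ : Finite Γ) (_ : Finite Λ)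
      (M : TM0.Machine Γ Λ) (input : ℕ → List Γ),
      (∀ e : Γ → ℕ, Primrec fun n => (input n).map e) ∧
      ¬ ComputablePred fun n => (StateTransition.eval (TM0.step M) (TM0.init (input n))).Dom := by
  classical
  -- The domain of `F` is the halting set on input `0`; a single program `c` for `F` is compiled,
  -- and the program to be simulated is its input.
  let F : ℕ →. ℕ := fun n => Nat.Partrec.Code.eval (Denumerable.ofNat Nat.Partrec.Code n) 0
  have hF : Partrec F :=
    Nat.Partrec.Code.eval_part.comp (Computable.ofNat Nat.Partrec.Code) (Computable.const 0)
  obtain ⟨c, hc⟩ := ToPartrec.Code.exists_code (Nat.Partrec'.part_iff₁.2 hF)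
  -- Machines start in the default state, so the default must be the entry point of the compiled
  -- `c`.
  let _ : Inhabited PartrecToTM2.Λ' := ⟨PartrecToTM2.trNormal c PartrecToTM2.Cont'.halt⟩
  let _ : Inhabited (Option PartrecToTM2.Γ') := ⟨none⟩
  let _ : Fintype PartrecToTM2.K' :=
    ⟨{.main, .rev, .aux, .stack}, fun x => by cases x <;> simp⟩
  have hsupp := TM1to0.tr_supports _ (TM2to1.tr_supports _
    (PartrecToTM2.tr_supports c PartrecToTM2.Cont'.halt))
  obtain ⟨Λ, hΛ, hfin, M, hM⟩ := exists_fintype_machine _ _ hsupp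
  refine ⟨TM2to1.Γ' PartrecToTM2.K' fun _ => PartrecToTM2.Γ', Λ, inferInstance, hΛ,
    inferInstance, hfin, M, inputTape, inputTape_map_primrec, fun hd => ?_⟩
  have hdom : ∀ n, (StateTransition.eval (TM0.step M) (TM0.init (inputTape n))).Dom ↔
      (F n).Dom := by
    intro n
    rw [hM, TM1to0.tr_eval]
    have h1 := TM2to1.tr_eval_dom PartrecToTM2.tr PartrecToTM2.K'.main (PartrecToTM2.trList [n])
    refine h1.trans ?_
    have h2 : TM2.init (Λ := PartrecToTM2.Λ') (σ := Option PartrecToTM2.Γ')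
        PartrecToTM2.K'.main (PartrecToTM2.trList [n]) = PartrecToTM2.init c [n] := by
      simp only [TM2.init, PartrecToTM2.init]
      congr 1
      funext k
      cases k <;> simp [PartrecToTM2.K'.elim, Function.update]
    have h3 := PartrecToTM2.tr_eval c [n]
    have h4 := hc (n ::ᵥ List.Vector.nil)
    change (StateTransition.eval _ _).Dom ↔ _
    rw [h2, h3]
    change (c.eval [n]).Dom ↔ _
    have h5 : c.eval [n] = pure <$> F n := h4
    rw [h5]
    rfl
  refine ComputablePred.halting_problem 0 (hd.computable_of_manyOneReducible ?_)
  refine ⟨Encodable.encode, Computable.encode, fun c => ?_⟩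
  refine Iff.trans ?_ (hdom _).symm
  simp [F]

end Machine

/-! ### Length-preserving string rewriting -/

section Rewriting

variable {A ι : Type} (lhs rhs : ι → Fin 3 → A)

/-- One step of the string rewriting system with the rules `lhs ρ → rhs ρ`. -/
def Rewrites (W W' : List A) : Prop :=
  ∃ x y ρ, W = x ++ [lhs ρ 0, lhs ρ 1, lhs ρ 2] ++ y ∧
    W' = x ++ [rhs ρ 0, rhs ρ 1, rhs ρ 2] ++ y

/-- A tile is a letter that is copied into the next row, or one of the three places where a rule
is applied. -/
abbrev Tile (A ι : Type) : Type := A ⊕ ι × Fin 3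

/-- The letter `f ρ i` at place `i` of the rule `ρ`. -/
def Tile.letter (f : ι → Fin 3 → A) : Tile A ι → A := Sum.elim id fun p => f p.1 p.2

/-- The tiles `t` and `t'` may be neighbours in a row. -/
def Adjacent (t t' : Tile A ι) : Prop :=
  ∀ (ρ : ι) (i : Fin 2), t = .inr (ρ, i.castSucc) ↔ t' = .inr (ρ, i.succ)

/-- A word made of consecutive rows of length `L`, each obtained from the previous one by applying
the rules that its tiles indicate. -/
structure IsHelix (L : ℕ) (u : List (Tile A ι)) : Prop where
  adjacent : u.IsChain Adjacent
  next : ∀ p (h : p + L < u.length), u[p + L].letter lhs = u[p].letter rhs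

variable {lhs rhs}

theorem Rewrites.cons {W W' : List A} (a : A) (h : Rewrites lhs rhs W W') :
    Rewrites lhs rhs (a :: W) (a :: W') := by
  obtain ⟨x, y, ρ, rfl, rfl⟩ := h
  exact ⟨a :: x, y, ρ, rfl, rfl⟩

theorem Rewrites.length_eq {W W' : List A} (h : Rewrites lhs rhs W W') :
    W.length = W'.length := by
  obtain ⟨x, y, ρ, rfl, rfl⟩ := h
  simp

theorem Adjacent.inl_inl {a b : A} : Adjacent (ι := ι) (.inl a) (.inl b) := by
  intro ρ i; simp

theorem Adjacent.not_inr_succ {a : A} {t : Tile A ι} (h : Adjacent (.inl a) t) (ρ : ι)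
    (i : Fin 2) : t ≠ .inr (ρ, i.succ) := fun e => by
  have := (h ρ i).2 e
  simp at this

/-- Reading from the left, a copying tile only extends the unchanged prefix, while a tile at place 0
forces places 1 and 2 after it, and this triple is one rewriting step. No rule overhangs the row:
the hypothesis on the head excludes it on the left, the plain tile `b` after the row on the right. A
row may apply several rules, hence the reflexive transitive closure. -/
theorem row_rewrites (b : A) (n : ℕ) : ∀ R : List (Tile A ι), R.length ≤ n →
    (R ++ [Sum.inl b]).IsChain Adjacent →
    (∀ t ∈ R.head?, ∀ ρ (i : Fin 2), t ≠ .inr (ρ, i.succ)) →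
    Relation.ReflTransGen (Rewrites lhs rhs) (R.map (Tile.letter lhs))
      (R.map (Tile.letter rhs)) := by
  induction n with
  | zero =>
    intro R hR _ _
    obtain rfl : R = [] := List.length_eq_zero_iff.1 (by omega)
    exact .refl
  | succ n ih =>
    intro R hR hc hh
    match R, hR, hc, hh with
    | [], _, _, _ => exact .refl
    | .inl a :: R, hR, hc, _ =>
      have hc' : (R ++ [Sum.inl b]).IsChain Adjacent := (List.isChain_append (l₁ := [_]).1 hc).2.1
      have := ih R (by simp at hR; omega) hc' (by
        intro t ht ρ i
        match R, ht with
        | t' :: R, ht =>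
          simp only [List.head?_cons, Option.mem_def, Option.some.injEq] at ht
          subst ht
          exact Adjacent.not_inr_succ (List.isChain_cons_cons.1 hc).1 ρ i)
      exact this.lift (a :: ·) fun _ _ h => h.cons a
    | .inr (ρ, i) :: R, hR, hc, hh =>
      have hi : i = 0 := by
        rcases Fin.eq_zero_or_eq_succ i with h | ⟨j, rfl⟩
        · exact h
        · exact absurd rfl (hh _ rfl ρ j)
      subst hi
      match R, hR, hc with
      | [], _, hc =>
        have := ((List.isChain_cons_cons.1 hc).1 ρ 0).1 rfl
        simp at this
      | [t], _, hc =>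
        have h1 := ((List.isChain_cons_cons.1 hc).1 ρ 0).1 rfl
        subst h1
        have := ((List.isChain_cons_cons.1 (List.isChain_cons_cons.1 hc).2).1 ρ 1).1 rfl
        simp at this
      | t :: t' :: R, hR, hc =>
        have h1 := ((List.isChain_cons_cons.1 hc).1 ρ 0).1 rfl
        subst h1
        have hc1 := (List.isChain_cons_cons.1 hc).2
        have h2 := ((List.isChain_cons_cons.1 hc1).1 ρ 1).1 rfl
        subst h2
        have hc2 := (List.isChain_cons_cons.1 hc1).2
        have hc' : (R ++ [Sum.inl b]).IsChain Adjacent := (List.isChain_append (l₁ := [_]).1 hc2).2.1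
        have := ih R (by simp at hR; omega) hc' (by
          intro t ht ρ' i
          match R, ht with
          | t' :: R, ht =>
            simp only [List.head?_cons, Option.mem_def, Option.some.injEq] at ht
            subst ht
            intro e
            have := ((List.isChain_cons_cons.1 hc2).1 ρ' i).2 e
            simp only [Sum.inr.injEq, Prod.mk.injEq] at this
            have h3 := congrArg Fin.val this.2
            have := i.isLt
            simp at h3
            omega)
        refine .head ⟨[], R.map (Tile.letter lhs), ρ, rfl, rfl⟩ ?_
        exact this.lift (fun W => [rhs ρ 0, rhs ρ 1, rhs ρ 2] ++ W)
          fun _ _ h => ((h.cons _).cons _).cons _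

/-- The row number `i` of a word with rows of length `L`. -/
def row (L : ℕ) (u : List (Tile A ι)) (i : ℕ) : List (Tile A ι) := (u.drop (i * L)).take L

theorem eq_inl_of_letter_eq {b : A} (hb : ∀ ρ i, lhs ρ i ≠ b) {t : Tile A ι}
    (h : t.letter lhs = b) : t = .inl b := by
  rcases t with a | ⟨ρ, i⟩
  · exact congrArg _ h
  · exact absurd h (hb ρ i)

/-- A letter that no rule consumes can only sit on a copying tile, so the border at position 0
recurs every `L` positions and marks the row boundaries. -/
theorem IsHelix.getElem_mul {L : ℕ} {u : List (Tile A ι)} (hu : IsHelix lhs rhs L u) {b : A}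
    (hb : ∀ ρ i, lhs ρ i ≠ b) (h0 : u[0]? = some (.inl b)) (i : ℕ) (h : i * L < u.length) :
    u[i * L] = .inl b := by
  induction i with
  | zero =>
    simp only [zero_mul] at h ⊢
    simpa [h] using h0
  | succ i ih =>
    have e : (i + 1) * L = i * L + L := by ring
    simp only [e] at h ⊢
    refine eq_inl_of_letter_eq hb ?_
    rw [hu.next _ h, ih (by omega)]
    rfl

/-- The rows of a helix are related by rewriting. -/
theorem IsHelix.reaches_row {L : ℕ} (hL : 0 < L) {u : List (Tile A ι)} (hu : IsHelix lhs rhs L u)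
    {b : A} (hb : ∀ ρ i, lhs ρ i ≠ b) (h0 : u[0]? = some (.inl b)) (i : ℕ)
    (h : (i + 1) * L ≤ u.length) :
    Relation.ReflTransGen (Rewrites lhs rhs) ((row L u 0).map (Tile.letter lhs))
      ((row L u i).map (Tile.letter lhs)) := by
  induction i with
  | zero => exact .refl
  | succ i ih =>
    have e1 : (i + 1) * L = i * L + L := by ring
    have e2 : (i + 1 + 1) * L = i * L + L + L := by ring
    rw [e2] at h
    refine (ih (by omega)).trans ?_
    have hrow : (row L u (i + 1)).map (Tile.letter lhs) = (row L u i).map (Tile.letter rhs) := by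
      apply List.ext_getElem
      · simp [row, e1]; omega
      · intro j h1 h2
        simp only [row, List.length_map, List.length_take, List.length_drop] at h1 h2
        have := hu.next (i * L + j) (by omega)
        simp only [row, List.getElem_map, List.getElem_take, List.getElem_drop, e1]
        rw [← this]
        congr 2
        omega
    rw [hrow]
    refine row_rewrites b L _ (by simp [row]) ?_ ?_
    -- One tile beyond the row is taken: it is the border that starts the next row.
    · have hc : ((u.drop (i * L)).take (L + 1)).IsChain Adjacent := (hu.adjacent.drop _).take _
      rw [List.take_add_one] at hc
      have hlt : (i + 1) * L < u.length := by omega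
      have := hu.getElem_mul hb h0 (i + 1) hlt
      have h' : (u.drop (i * L))[L]? = some (.inl b) := by
        rw [List.getElem?_drop, ← e1, List.getElem?_eq_getElem hlt, this]
      rw [h'] at hc
      exact hc
    · intro t ht ρ j
      have := hu.getElem_mul hb h0 i (by omega)
      rw [row, List.head?_take, if_neg (by omega), List.head?_drop,
        List.getElem?_eq_getElem (by omega), this] at ht
      simp only [Option.mem_def, Option.some.injEq] at ht
      subst ht
      simp

/-- A row can be put before a helix. -/
theorem IsHelix.append {L : ℕ} {R u : List (Tile A ι)} (hu : IsHelix lhs rhs L u)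
    (hR : R.length = L) (hc : R.IsChain Adjacent)
    (hend : ∀ t ∈ R.getLast?, ∀ t' ∈ u.head?, Adjacent t t')
    (h : (u.take L).map (Tile.letter lhs) = R.map (Tile.letter rhs)) :
    IsHelix lhs rhs L (R ++ u) := by
  refine ⟨List.isChain_append.2 ⟨hc, hu.adjacent, hend⟩, fun p hp => ?_⟩
  simp only [List.length_append, hR] at hp
  rw [List.getElem_append_right (by omega)]
  by_cases hpL : p < L
  · rw [List.getElem_append_left (by omega)]
    have := List.getElem_of_eq h (i := p) (by simp; omega)
    simpa [hR] using this
  · rw [List.getElem_append_right (by omega)]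
    have := hu.next (p - L) (by omega)
    simp only [hR]
    rw [← this]
    congr 2
    omega

theorem isChain_map_inl (l : List A) : (l.map (Sum.inl : A → Tile A ι)).IsChain Adjacent := by
  rw [List.isChain_iff_getElem]
  intro i hi
  simp [Adjacent.inl_inl]

/-- The row in which the rule `ρ` is applied between `x` and `y`. -/
def ruleRow (x y : List A) (ρ : ι) : List (Tile A ι) :=
  (x.map .inl ++ [.inr (ρ, 0), .inr (ρ, 1), .inr (ρ, 2)]) ++ y.map .inl

theorem ruleRow_map (f : ι → Fin 3 → A) (x y : List A) (ρ : ι) :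
    (ruleRow x y ρ).map (Tile.letter f) = x ++ [f ρ 0, f ρ 1, f ρ 2] ++ y := by
  simp [ruleRow, Tile.letter, Function.comp_def]

theorem adjacent_inr_two (ρ : ι) (a : A) : Adjacent (.inr (ρ, 2)) (.inl a) := by
  intro ρ' i
  fin_cases i <;> simp

theorem ruleRow_isChain (x y : List A) (ρ : ι) : (ruleRow x y ρ).IsChain Adjacent := by
  have h01 : Adjacent (A := A) (.inr (ρ, 0)) (.inr (ρ, 1)) := by
    intro ρ' i
    fin_cases i <;> simp
  have h12 : Adjacent (A := A) (.inr (ρ, 1)) (.inr (ρ, 2)) := by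
    intro ρ' i
    fin_cases i <;> simp
  refine List.isChain_append.2 ⟨List.isChain_append.2 ⟨isChain_map_inl _, by simp [h01, h12], ?_⟩,
    isChain_map_inl _, ?_⟩
  · intro z hz w hw
    obtain ⟨c, _, rfl⟩ := List.mem_map.1 (List.mem_of_mem_getLast? hz)
    simp only [List.head?_cons, Option.mem_def, Option.some.injEq] at hw
    subst hw
    intro ρ' i
    fin_cases i <;> simp
  · intro z hz w hw
    obtain ⟨c, _, rfl⟩ := List.mem_map.1 (List.mem_of_mem_head? hw)
    rw [List.getLast?_append_of_ne_nil _ (by simp)] at hz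
    simp only [List.getLast?_cons_cons, List.getLast?_singleton, Option.mem_def,
      Option.some.injEq] at hz
    subst hz
    exact adjacent_inr_two ρ c

theorem ruleRow_getLast (x y : List A) (ρ : ι) (a : A) :
    ∀ t ∈ (ruleRow x y ρ).getLast?, Adjacent t (.inl a) := by
  intro z hz
  rcases List.eq_nil_or_concat y with rfl | ⟨y, d, rfl⟩
  · rw [ruleRow, List.map_nil, List.append_nil, List.getLast?_append_of_ne_nil _ (by simp)] at hz
    simp only [List.getLast?_cons_cons, List.getLast?_singleton, Option.mem_def,
      Option.some.injEq] at hz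
    subst hz
    exact adjacent_inr_two ρ a
  · rw [ruleRow, List.getLast?_append_of_ne_nil _ (by simp)] at hz
    obtain ⟨c, _, rfl⟩ := List.mem_map.1 (List.mem_of_mem_getLast? hz)
    exact .inl_inl

/-- A rewriting sequence can be written as a helix. -/
theorem exists_isHelix {b : A} (hb : ∀ ρ i, lhs ρ i ≠ b) {L : ℕ} {W W' : List A}
    (h : Relation.ReflTransGen (Rewrites lhs rhs) W W') (hW : W.head? = some b)
    (hL : W.length = L) :
    ∃ u, IsHelix lhs rhs L u ∧ (u.take L).map (Tile.letter lhs) = W ∧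
      2 * L ≤ u.length ∧ u[0]? = some (.inl b) ∧
      ∀ a ∈ W', ∃ p, ∃ h : p + L < u.length, u[p].letter lhs = a := by
  induction h using Relation.ReflTransGen.head_induction_on with
  | refl =>
    have htake : ((W'.map (Sum.inl : A → Tile A ι)).take L) = W'.map .inl :=
      List.take_of_length_le (by simp [hL])
    -- The final word is written twice, so that each of its letters occurs with a further tile `L`
    -- places later.
    refine ⟨W'.map .inl ++ W'.map .inl, ?_, ?_, ?_, ?_, ?_⟩
    · refine IsHelix.append ⟨isChain_map_inl _, ?_⟩ (by simp [hL]) (isChain_map_inl _) ?_ ?_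
      · intro p hp
        simp at hp
        omega
      · intro x hx y hy
        obtain ⟨a, _, rfl⟩ := List.mem_map.1 (List.mem_of_mem_getLast? hx)
        obtain ⟨a, _, rfl⟩ := List.mem_map.1 (List.mem_of_mem_head? hy)
        exact .inl_inl
      · simp [htake, Tile.letter, Function.comp_def]
    · rw [List.take_append_of_le_length (by simp [hL]), htake]
      simp [Tile.letter, Function.comp_def]
    · simp; omega
    · match W', hW with
      | a :: W', hW => simpa using hW
    · intro a ha
      obtain ⟨p, hp, rfl⟩ := List.mem_iff_getElem.1 ha
      refine ⟨p, by simp; omega, ?_⟩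
      simp [hp, Tile.letter]
  | head hstep _ ih =>
    have hlen := hstep.length_eq
    obtain ⟨x, y, ρ, rfl, rfl⟩ := hstep
    match x, hW with
    -- With nothing to its left, the rule would consume the border.
    | [], hW =>
      simp only [List.nil_append, List.cons_append, List.head?_cons, Option.some.injEq] at hW
      exact absurd hW (hb _ _)
    | a :: x, hW =>
      obtain ⟨u, hu, htake, hlen2, h0, hmem⟩ := ih (by simpa using hW) (by rw [← hlen, hL])
      have hR : (ruleRow (a :: x) y ρ).length = L := by
        rw [← hL, ← ruleRow_map lhs, List.length_map]
      refine ⟨ruleRow (a :: x) y ρ ++ u, ?_, ?_, ?_, ?_, ?_⟩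
      · refine hu.append hR (ruleRow_isChain _ _ _) ?_ ?_
        · intro z hz w hw
          rw [List.head?_eq_getElem?, h0] at hw
          simp only [Option.mem_def, Option.some.injEq] at hw
          subst hw
          exact ruleRow_getLast _ _ _ _ z hz
        · rw [htake, ruleRow_map]
      · rw [← hR, List.take_left, ruleRow_map]
      · simp only [List.length_append, hR]; omega
      · have : a = b := by simpa using hW
        simp [ruleRow, this]
      · intro c hc
        obtain ⟨p, hp, hpc⟩ := hmem c hc
        refine ⟨L + p, by simp only [List.length_append, hR]; omega, ?_⟩
        rw [List.getElem_append_right (by omega)]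
        simpa [hR] using hpc

end Rewriting

/-! ### Turing machines as rewriting systems -/

section TuringRewriting

open Turing

variable {Γ Λ : Type}

/-- The letters of configurations: a border, tape symbols, and states; the letter
`some (.inr none)` shows that the machine has halted. -/
abbrev ConfLetter (Γ Λ : Type) : Type := Option (Γ ⊕ Option Λ)

/-- The letter of a tape symbol. -/
def ConfLetter.cell (a : Γ) : ConfLetter Γ Λ := some (.inl a)

/-- The letter of a state, or of the end of the computation. -/
def ConfLetter.state (q : Option Λ) : ConfLetter Γ Λ := some (.inr q)

open ConfLetter

/-- A rule `(b, q, a)` applies in state `q` when the head reads `a` and `b` is to its left. -/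
def ruleLhs (ρ : Γ × Λ × Γ) : Fin 3 → ConfLetter Γ Λ := ![cell ρ.1, state (some ρ.2.1), cell ρ.2.2]

/-- The result of a rule. -/
def ruleRhs [Inhabited Λ] (M : TM0.Machine Γ Λ) (ρ : Γ × Λ × Γ) : Fin 3 → ConfLetter Γ Λ :=
  match M ρ.2.1 ρ.2.2 with
  | none => ![cell ρ.1, state none, cell ρ.2.2]
  | some (q', .move .left) => ![state (some q'), cell ρ.1, cell ρ.2.2]
  | some (q', .move .right) => ![cell ρ.1, cell ρ.2.2, state (some q')]
  | some (q', .write a) => ![cell ρ.1, state (some q'), cell a]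

theorem ruleLhs_ne_none (ρ : Γ × Λ × Γ) (i : Fin 3) : ruleLhs ρ i ≠ none := by
  fin_cases i <;> simp [ruleLhs, cell, state]

/-- The word for the state `q` and the tape with `l` (reversed) to the left of the head and `r`
from the head on. -/
def confWord (q : Option Λ) (l r : List Γ) : List (ConfLetter Γ Λ) :=
  none :: l.reverse.map cell ++ state q :: r.map cell

variable [Inhabited Γ]

/-- The configuration described by `confWord`. -/
def conf (q : Λ) (l r : List Γ) : TM0.Cfg Γ Λ := ⟨q, Tape.mk' (ListBlank.mk l) (ListBlank.mk r)⟩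

/-- Used to locate the unique state letter of a configuration word, which determines where a rule
can apply. -/
theorem append_cons_unique {α : Type} {P : α → Prop} {A B A' B' : List α} {s s' : α}
    (h : A ++ s :: B = A' ++ s' :: B') (hs' : P s') (hA : ∀ a ∈ A, ¬ P a)
    (hB : ∀ a ∈ B, ¬ P a) : A = A' ∧ s = s' ∧ B = B' := by
  rcases List.append_eq_append_iff.1 h with ⟨C, rfl, hC⟩ | ⟨C, rfl, hC⟩
  · rcases C with _ | ⟨c, C⟩
    · simp at hC; simp [hC]
    · simp at hC
      exact absurd hs' (hB _ (by simp [hC.2]))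
  · rcases C with _ | ⟨c, C⟩
    · simp at hC; simp [hC]
    · simp at hC
      exact absurd hs' (hA _ (by simp [hC.1]))

variable [Inhabited Λ] (M : TM0.Machine Γ Λ)

theorem conf_step_left {q q' : Λ} {a b : Γ} (l r : List Γ)
    (h : M q a = some (q', .move .left)) :
    TM0.step M (conf q (b :: l) (a :: r)) = some (conf q' l (b :: a :: r)) := by
  simp [TM0.step, conf, h, Tape.mk'_head, Tape.move_left_mk']

theorem conf_step_right {q q' : Λ} {a : Γ} (l r : List Γ)
    (h : M q a = some (q', .move .right)) :
    TM0.step M (conf q l (a :: r)) = some (conf q' (a :: l) r) := by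
  simp [TM0.step, conf, h, Tape.mk'_head, Tape.move_right_mk']

theorem conf_step_write {q q' : Λ} {a a' : Γ} (l r : List Γ)
    (h : M q a = some (q', .write a')) :
    TM0.step M (conf q l (a :: r)) = some (conf q' l (a' :: r)) := by
  simp [TM0.step, conf, h, Tape.mk'_head, Tape.write_mk']

theorem conf_step_none {q : Λ} {a : Γ} (l r : List Γ) (h : M q a = none) :
    TM0.step M (conf q l (a :: r)) = none := by
  simp [TM0.step, conf, h, Tape.mk'_head]

/-- The words that rewriting can reach from the initial configuration. -/
def Reachable (c : TM0.Cfg Γ Λ) (W : List (ConfLetter Γ Λ)) : Prop :=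
  (∃ q l r, W = confWord (some q) l r ∧ StateTransition.Reaches (TM0.step M) c (conf q l r)) ∨
    (StateTransition.eval (TM0.step M) c).Dom

variable {M}

/-- A configuration word has only one state letter, so the applicable rule is dictated by the
machine and simulates its step. If the machine has no step, it has halted, and the second
alternative of `Reachable` puts no condition on later words. -/
theorem Reachable.rewrites {c : TM0.Cfg Γ Λ} {W W' : List (ConfLetter Γ Λ)} (h : Reachable M c W)
    (hW : Rewrites ruleLhs (ruleRhs M) W W') : Reachable M c W' := by
  rcases h with ⟨q, l, r, rfl, hr⟩ | h
  · obtain ⟨x, y, ⟨b, q₀, a⟩, h1, rfl⟩ := hW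
    have h2 : (none :: l.reverse.map cell) ++ state (some q) :: r.map cell =
        (x ++ [cell b]) ++ state (some q₀) :: (cell a :: y) := by
      simpa [confWord, ruleLhs] using h1
    obtain ⟨h3, h4, h5⟩ := append_cons_unique (P := fun s => ∃ q : Option Λ, s = state q) h2
      ⟨_, rfl⟩ (by simp [state, cell]) (by simp [state, cell])
    obtain rfl : q = q₀ := by simpa [state] using h4
    rcases r with _ | ⟨a', r⟩
    · simp at h5
    obtain ⟨rfl, rfl⟩ : a' = a ∧ r.map cell = y := by simpa [cell] using h5
    rcases l with _ | ⟨b', l⟩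
    · rcases x with _ | ⟨_, x⟩ <;> simp [cell] at h3
    have h6 : none :: l.reverse.map cell ++ [cell b'] = x ++ [cell b] := by simpa using h3
    obtain ⟨rfl, h7⟩ := List.append_inj' h6 rfl
    obtain rfl : b' = b := by simpa [cell] using h7
    rcases hM : M q a' with _ | ⟨q', (_ | _) | a''⟩
    · exact .inr (Part.dom_iff_mem.2 ⟨_, StateTransition.mem_eval.2
        ⟨hr, conf_step_none M _ _ hM⟩⟩)
    · exact .inl ⟨q', l, b' :: a' :: r, by simp [confWord, ruleRhs, hM],
        hr.tail (conf_step_left M _ _ hM)⟩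
    · exact .inl ⟨q', a' :: b' :: l, r, by simp [confWord, ruleRhs, hM],
        hr.tail (conf_step_right M _ _ hM)⟩
    · exact .inl ⟨q', b' :: l, a'' :: r, by simp [confWord, ruleRhs, hM],
        hr.tail (conf_step_write M _ _ hM)⟩
  · exact .inr h

/-- A rule needs a symbol on each side of the state letter, and a step uses up at most one symbol on
either side. So one more symbol per step, plus one for the halting rule, is enough room; `l` and `r`
are any lists of that length representing the tape. -/
theorem exists_rewrites_halt {c c' : TM0.Cfg Γ Λ}
    (h : StateTransition.Reaches (TM0.step M) c c') (hc' : TM0.step M c' = none) :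
    ∃ n, ∀ q l r, conf q l r = c → n ≤ l.length → n ≤ r.length →
      ∃ W, Relation.ReflTransGen (Rewrites ruleLhs (ruleRhs M)) (confWord (some q) l r) W ∧
        state none ∈ W := by
  have key : ∀ (q : Λ) (a b : Γ) (l r : List Γ) (W' : List (ConfLetter Γ Λ)),
      W' = none :: l.reverse.map cell ++ [ruleRhs M (b, q, a) 0, ruleRhs M (b, q, a) 1,
        ruleRhs M (b, q, a) 2] ++ r.map cell →
      Rewrites ruleLhs (ruleRhs M) (confWord (some q) (b :: l) (a :: r)) W' := by
    rintro q a b l r W' rfl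
    exact ⟨none :: l.reverse.map cell, r.map cell, (b, q, a), by simp [confWord, ruleLhs], rfl⟩
  induction h using Relation.ReflTransGen.head_induction_on with
  | refl =>
    refine ⟨1, ?_⟩
    rintro q (_ | ⟨b, l⟩) (_ | ⟨a, r⟩) hc h1 h2 <;> simp at h1 h2
    have hM : M q a = none := by
      rw [← hc] at hc'
      simpa [TM0.step, conf, Tape.mk'_head] using hc'
    refine ⟨confWord none (b :: l) (a :: r), .single (key _ _ _ _ _ _ ?_), by simp [confWord]⟩
    simp [confWord, ruleRhs, hM]
  | head hstep _ ih =>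
    obtain ⟨n, ih⟩ := ih
    refine ⟨n + 1, ?_⟩
    rintro q (_ | ⟨b, l⟩) (_ | ⟨a, r⟩) hc h1 h2 <;> simp at h1 h2
    rw [← hc] at hstep
    rcases hM : M q a with _ | ⟨q', (_ | _) | a''⟩
    · rw [conf_step_none M _ _ hM] at hstep
      simp at hstep
    · rw [conf_step_left M _ _ hM] at hstep
      obtain ⟨W, hW, hm⟩ := ih q' l (b :: a :: r) (Option.some.inj hstep) (by omega)
        (by simp; omega)
      exact ⟨W, .head (key _ _ _ _ _ _ (by simp [confWord, ruleRhs, hM])) hW, hm⟩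
    · rw [conf_step_right M _ _ hM] at hstep
      obtain ⟨W, hW, hm⟩ := ih q' (a :: b :: l) r (Option.some.inj hstep) (by simp; omega)
        (by omega)
      exact ⟨W, .head (key _ _ _ _ _ _ (by simp [confWord, ruleRhs, hM])) hW, hm⟩
    · rw [conf_step_write M _ _ hM] at hstep
      obtain ⟨W, hW, hm⟩ := ih q' (b :: l) (a'' :: r) (Option.some.inj hstep) (by simp; omega)
        (by simp; omega)
      exact ⟨W, .head (key _ _ _ _ _ _ (by simp [confWord, ruleRhs, hM])) hW, hm⟩

theorem listBlank_mk_append_replicate (l : List Γ) (n : ℕ) :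
    ListBlank.mk (l ++ List.replicate n default) = ListBlank.mk l :=
  Quotient.sound' (.inr ⟨n, rfl⟩)

/-- The initial word with `i` blanks before the head and `j` blanks after the input. -/
def initWord (Λ : Type) [Inhabited Λ] (input : List Γ) (i j : ℕ) : List (ConfLetter Γ Λ) :=
  confWord (some default) (List.replicate i default) (input ++ List.replicate j default)

variable (M)

/-- A machine halts iff its rewriting system reaches the halting letter, for some amount of
blank space around the input. -/
theorem eval_dom_iff_rewrites (input : List Γ) :
    (StateTransition.eval (TM0.step M) (TM0.init input)).Dom ↔
      ∃ i j W, Relation.ReflTransGen (Rewrites ruleLhs (ruleRhs M)) (initWord Λ input i j) W ∧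
        state none ∈ W := by
  have hinit : ∀ i j, conf (default : Λ) (List.replicate i default)
      (input ++ List.replicate j default) = TM0.init input := by
    intro i j
    have h := listBlank_mk_append_replicate ([] : List Γ) i
    rw [List.nil_append] at h
    simp only [conf, TM0.init, Tape.mk₁, Tape.mk₂, listBlank_mk_append_replicate, h]
  constructor
  · intro h
    obtain ⟨c, hc⟩ := Part.dom_iff_mem.1 h
    obtain ⟨h1, h2⟩ := StateTransition.mem_eval.1 hc
    obtain ⟨n, hn⟩ := exists_rewrites_halt h1 h2
    -- Padding with blanks leaves the tape unchanged and gives the head enough room for the whole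
    -- run.
    exact ⟨n, n, hn _ _ _ (hinit n n) (by simp) (by simp)⟩
  · rintro ⟨i, j, W, hW, hm⟩
    have : Reachable M (TM0.init input) W := by
      clear hm
      induction hW with
      | refl => exact .inl ⟨_, _, _, rfl, by rw [hinit]; exact .refl⟩
      | tail _ h ih => exact ih.rewrites h
    rcases this with ⟨q, l, r, rfl, _⟩ | h
    · simp [confWord, state, cell] at hm
    · exact h

end TuringRewriting

/-! ### Derived formulas -/

section DerivedFormulas

variable {k : ℕ}

/-- Falsity. -/
def Formula.bot : Formula k := .neg .top

/-- Conjunction. -/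
def Formula.and (φ ψ : Formula k) : Formula k := .neg (.or (.neg φ) (.neg ψ))

/-- The next position satisfies `φ`. -/
def Formula.next (φ : Formula k) : Formula k := .untl .glob .univ .bot φ

/-- The abstract successor satisfies `φ`. -/
def Formula.absNext (φ : Formula k) : Formula k := .untl .abs .univ .bot φ

/-- Some position from now on satisfies `φ`. -/
def Formula.eventually (φ : Formula k) : Formula k := .or φ (.untl .glob .univ .top φ)

/-- The interval `[n, n]`. -/
def Interval.point (n : ℕ) : Interval := ⟨n, true, some (n, true), by simp⟩

/-- Some later position at distance exactly one satisfies `φ`. -/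
def Formula.after (φ : Formula k) : Formula k := .untl .glob (.point 1) .top φ

/-- The next position has the same time. -/
def Formula.simultaneous : Formula k := .untl .glob (.point 0) .bot .top

/-- No position from now on satisfies `φ`. -/
def Formula.never (φ : Formula k) : Formula k := .neg φ.eventually

/-- The conjunction of a list of formulas. -/
def Formula.conj : List (Formula k) → Formula k := List.foldr .and .top

/-- The disjunction of the formulas `f a` over all `a` with `P a`. -/
noncomputable def Formula.anyOf {α : Type} [Finite α] (P : α → Prop) (f : α → Formula k) :
    Formula k :=
  ((Set.toFinite {a | P a}).toFinset.toList.map f).foldr .or .bot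

variable {w : TimedWord k} {i : Fin w.letters.length} {φ ψ : Formula k}

theorem Interval.mem_univ {x : ℝ} : x ∈ Interval.univ.toSet ↔ 0 ≤ x := by
  simp [Interval.univ, Interval.toSet]

theorem Interval.mem_point {n : ℕ} {x : ℝ} : x ∈ (Interval.point n).toSet ↔ x = n := by
  simp only [Interval.point, Interval.toSet, if_true, Set.mem_ofPred_eq, Option.mem_def,
    Option.some.injEq]
  constructor
  · rintro ⟨h1, h2⟩
    exact le_antisymm (by simpa using h2 _ rfl) h1
  · rintro rfl
    exact ⟨le_rfl, by rintro _ rfl; simp⟩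

theorem TimedWord.sub_mem_univ (w : TimedWord k) {i j : Fin w.letters.length} (h : i ≤ j) :
    ((w.time j : ℝ) - (w.time i : ℝ)) ∈ Interval.univ.toSet := by
  rw [Interval.mem_univ, sub_nonneg]
  exact_mod_cast w.mono h

@[simp] theorem holds_bot : ¬ Holds w i .bot := by simp [Formula.bot, Holds]

@[simp] theorem holds_and : Holds w i (φ.and ψ) ↔ Holds w i φ ∧ Holds w i ψ := by
  simp [Formula.and, Holds]

@[simp] theorem holds_neg : Holds w i φ.neg ↔ ¬ Holds w i φ := by simp [Holds]

@[simp] theorem holds_top : Holds w i .top := by simp [Holds]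

@[simp] theorem holds_atom {p : AP k} :
    Holds w i (.atom p) ↔ p ∈ (w.letters.get i).1 := by simp [Holds]

theorem holds_next : Holds w i φ.next ↔
    ∃ h : (i : ℕ) + 1 < w.letters.length, Holds w ⟨i + 1, h⟩ φ := by
  simp only [Formula.next, Holds, FDir.pos, Set.mem_univ, true_and, holds_bot]
  constructor
  · rintro ⟨j, hj, hφ, -, hl⟩
    have h : (i : ℕ) + 1 < w.letters.length := lt_of_le_of_lt (Nat.succ_le_of_lt hj) j.2
    refine ⟨h, ?_⟩
    rcases eq_or_lt_of_le (Nat.succ_le_of_lt hj : (i : ℕ) + 1 ≤ j) with e | e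
    · have : (⟨i + 1, h⟩ : Fin _) = j := Fin.ext e
      rwa [this]
    · exact (hl ⟨i + 1, h⟩ (Nat.lt_succ_self _) e trivial).elim
  · rintro ⟨h, hφ⟩
    refine ⟨⟨i + 1, h⟩, Nat.lt_succ_self _, hφ, w.sub_mem_univ (Nat.le_succ _), ?_⟩
    intro l h1 h2 _
    have h1' : (i : ℕ) < l := h1
    have h2' : (l : ℕ) < i + 1 := h2
    omega

theorem holds_untl_univ : Holds w i (.untl .glob .univ φ ψ) ↔
    ∃ j, i < j ∧ Holds w j ψ ∧ ∀ l, i < l → l < j → Holds w l φ := by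
  simp only [Holds, FDir.pos, Set.mem_univ, true_and, forall_true_left]
  constructor
  · rintro ⟨j, h1, h2, -, h3⟩; exact ⟨j, h1, h2, h3⟩
  · rintro ⟨j, h1, h2, h3⟩; exact ⟨j, h1, h2, w.sub_mem_univ h1.le, h3⟩

theorem holds_eventually : Holds w i φ.eventually ↔ ∃ j, i ≤ j ∧ Holds w j φ := by
  rw [Formula.eventually, Holds, holds_untl_univ]
  constructor
  · rintro (h | ⟨j, hj, h, -⟩)
    · exact ⟨i, le_rfl, h⟩
    · exact ⟨j, hj.le, h⟩
  · rintro ⟨j, hj, h⟩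
    rcases eq_or_lt_of_le hj with rfl | hj
    · exact .inl h
    · exact .inr ⟨j, hj, h, by simp⟩

theorem holds_never {h : 0 < w.letters.length} :
    Holds w ⟨0, h⟩ φ.never ↔ ∀ j, ¬ Holds w j φ := by
  rw [Formula.never, holds_neg, holds_eventually]
  simp only [not_exists, not_and]
  exact ⟨fun H j => H j (Nat.zero_le _), fun H j _ => H j⟩

theorem holds_after : Holds w i φ.after ↔ ∃ j, w.time j = w.time i + 1 ∧ Holds w j φ := by
  simp only [Formula.after, Holds, FDir.pos, Set.mem_univ, true_and, Interval.mem_point]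
  have key : ∀ j, ((w.time j : ℝ) - w.time i = ((1 : ℕ) : ℝ)) ↔ w.time j = w.time i + 1 := by
    intro j
    rw [sub_eq_iff_eq_add, ← NNReal.coe_inj]
    simp [add_comm]
  simp only [key]
  constructor
  · rintro ⟨j, -, h1, h2, -⟩; exact ⟨j, h2, h1⟩
  · rintro ⟨j, h1, h2⟩
    refine ⟨j, ?_, h2, h1, by simp⟩
    -- The until demands `i < j`; this is automatic, since otherwise monotonicity of time would give
    -- `w.time i + 1 ≤ w.time i`.
    by_contra hc
    have := w.mono (not_lt.1 hc)
    rw [h1] at this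
    exact absurd this (by simp)

theorem holds_simultaneous : Holds w i .simultaneous ↔
    ∃ h : (i : ℕ) + 1 < w.letters.length, w.time ⟨i + 1, h⟩ = w.time i := by
  simp only [Formula.simultaneous, Holds, FDir.pos, Set.mem_univ, true_and, holds_bot,
    Interval.mem_point, Nat.cast_zero, sub_eq_zero, NNReal.coe_inj]
  constructor
  · rintro ⟨j, hj, ht, hl⟩
    have h : (i : ℕ) + 1 < w.letters.length := lt_of_le_of_lt (Nat.succ_le_of_lt hj) j.2
    refine ⟨h, ?_⟩
    rcases eq_or_lt_of_le (Nat.succ_le_of_lt hj : (i : ℕ) + 1 ≤ j) with e | e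
    · have : (⟨i + 1, h⟩ : Fin _) = j := Fin.ext e
      rwa [this]
    · exact (hl ⟨i + 1, h⟩ (Nat.lt_succ_self _) e trivial).elim
  · rintro ⟨h, ht⟩
    refine ⟨⟨i + 1, h⟩, Nat.lt_succ_self _, ht, ?_⟩
    intro l h1 h2 _
    have h1' : (i : ℕ) < l := h1
    have h2' : (l : ℕ) < i + 1 := h2
    omega

theorem holds_conj {l : List (Formula k)} :
    Holds w i (.conj l) ↔ ∀ φ ∈ l, Holds w i φ := by
  induction l with
  | nil => simp [Formula.conj]
  | cons φ l ih =>
    have : Formula.conj (φ :: l) = φ.and (.conj l) := rfl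
    simp [this, ih]

theorem holds_anyOf {α : Type} [Finite α] {P : α → Prop} {f : α → Formula k} :
    Holds w i (.anyOf P f) ↔ ∃ a, P a ∧ Holds w i (f a) := by
  have key : ∀ l : List (Formula k), Holds w i (l.foldr Formula.or Formula.bot) ↔ ∃ φ ∈ l, Holds w i φ := by
    intro l
    induction l with
    | nil => simp
    | cons φ l ih => simp [Holds, ih]
  simp [Formula.anyOf, key]

theorem isFutureAbsNext_conj {l : List (Formula k)} (h : ∀ φ ∈ l, φ.IsFutureAbsNext) :
    (Formula.conj l).IsFutureAbsNext := by
  induction l with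
  | nil => trivial
  | cons φ l ih =>
    exact ⟨h φ (by simp), ih fun ψ hψ => h ψ (by simp [hψ])⟩

theorem isFutureAbsNext_anyOf {α : Type} [Finite α] {P : α → Prop} {f : α → Formula k}
    (h : ∀ a, (f a).IsFutureAbsNext) : (Formula.anyOf P f).IsFutureAbsNext := by
  have key : ∀ l : List α, ((l.map f).foldr Formula.or Formula.bot).IsFutureAbsNext := by
    intro l
    induction l with
    | nil => trivial
    | cons a l ih => exact ⟨h a, ih⟩
  exact key _

theorem Formula.IsFutureAbsNext.isFuture (h : φ.IsFutureAbsNext) : φ.IsFuture := by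
  induction φ with
  | top => trivial
  | atom => trivial
  | or φ ψ ih1 ih2 => exact ⟨ih1 h.1, ih2 h.2⟩
  | neg φ ih => exact ih h
  | untl d I φ ψ ih1 ih2 =>
    cases d with
    | glob => exact ⟨ih1 h.1, ih2 h.2⟩
    | abs => exact ⟨by rw [h.2.1]; trivial, ih2 h.2.2⟩
  | snce => exact h.elim

end DerivedFormulas

/-! ### Matching returns -/

section Matching

variable {k : ℕ}

theorem Letter.isCall_iff (a : Letter k) : IsCall a.1 ↔ AP.call ∈ a.1 := by
  have h := a.2
  simp only [IsCall, IsRet, IsInt, Set.ext_iff, Set.mem_inter_iff, Set.mem_insert_iff,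
    Set.mem_singleton_iff] at h ⊢
  constructor
  · intro h; exact ((h .call).2 rfl).1
  · intro hc
    rcases h with h | h | h
    · exact h
    · exact absurd ((h .call).1 (by simp [hc])) (by simp)
    · exact absurd ((h .call).1 (by simp [hc])) (by simp)

theorem Letter.isRet_iff (a : Letter k) : IsRet a.1 ↔ AP.ret ∈ a.1 := by
  have h := a.2
  simp only [IsCall, IsRet, IsInt, Set.ext_iff, Set.mem_inter_iff, Set.mem_insert_iff,
    Set.mem_singleton_iff] at h ⊢
  constructor
  · intro h; exact ((h .ret).2 rfl).1
  · intro hc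
    rcases h with h | h | h
    · exact absurd ((h .ret).1 (by simp [hc])) (by simp)
    · exact h
    · exact absurd ((h .ret).1 (by simp [hc])) (by simp)

theorem Letter.isInt_of_not (a : Letter k) (h1 : ¬ IsCall a.1) (h2 : ¬ IsRet a.1) :
    IsInt a.1 := by
  rcases a.2 with h | h | h
  · exact absurd h h1
  · exact absurd h h2
  · exact h

theorem not_isRet_of_isCall {P : Set (AP k)} (h : IsCall P) : ¬ IsRet P := by
  intro h'
  have := h.symm.trans h'
  simp at this

theorem IsInt.not_isCall {P : Set (AP k)} (h : IsInt P) : ¬ IsCall P := by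
  intro h'
  have := h.symm.trans h'
  simp at this

theorem IsInt.not_isRet {P : Set (AP k)} (h : IsInt P) : ¬ IsRet P := by
  intro h'
  have := h.symm.trans h'
  simp at this

/-! ### Counting calls and returns, and uniqueness of the matching return -/

open Classical in
/-- The number of calls. -/
noncomputable def numCalls (u : List (Letter k)) : ℕ := u.countP fun a => IsCall a.1

open Classical in
/-- The number of returns. -/
noncomputable def numRets (u : List (Letter k)) : ℕ := u.countP fun a => IsRet a.1

theorem numCalls_append (u v : List (Letter k)) :
    numCalls (u ++ v) = numCalls u + numCalls v := by simp [numCalls]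

theorem numRets_append (u v : List (Letter k)) :
    numRets (u ++ v) = numRets u + numRets v := by simp [numRets]

theorem num_cons_call {c : Letter k} (hc : IsCall c.1) (u : List (Letter k)) :
    numCalls (c :: u) = numCalls u + 1 ∧ numRets (c :: u) = numRets u := by
  simp [numCalls, numRets, hc, not_isRet_of_isCall hc]

theorem num_cons_ret {c : Letter k} (hc : IsRet c.1) (u : List (Letter k)) :
    numCalls (c :: u) = numCalls u ∧ numRets (c :: u) = numRets u + 1 := by
  have : ¬ IsCall c.1 := fun h => not_isRet_of_isCall h hc
  simp [numCalls, numRets, hc, this]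

theorem num_cons_int {c : Letter k} (hc : IsInt c.1) (u : List (Letter k)) :
    numCalls (c :: u) = numCalls u ∧ numRets (c :: u) = numRets u := by
  simp [numCalls, numRets, hc.not_isCall, hc.not_isRet]

theorem WellMatched.num_eq {u : List (Letter k)} (h : WellMatched u) :
    numCalls u = numRets u := by
  induction h with
  | nil => simp [numCalls, numRets]
  | internal a w ha _ ih => rw [(num_cons_int ha w).1, (num_cons_int ha w).2, ih]
  | matched c r w w' hc hr _ _ ih ih' =>
    rw [(num_cons_call hc _).1, (num_cons_call hc _).2, numCalls_append, numRets_append,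
      (num_cons_ret hr _).1, (num_cons_ret hr _).2]
    omega

theorem WellMatched.num_le {u : List (Letter k)} (h : WellMatched u) :
    ∀ v, v <+: u → numRets v ≤ numCalls v := by
  induction h with
  | nil =>
    intro v hv
    obtain rfl : v = [] := List.prefix_nil.1 hv
    simp [numCalls, numRets]
  | internal a w ha _ ih =>
    rintro (_ | ⟨b, v⟩) hv
    · simp [numCalls, numRets]
    · obtain ⟨rfl, hv'⟩ := List.cons_prefix_cons.1 hv
      rw [(num_cons_int ha v).1, (num_cons_int ha v).2]
      exact ih v hv'
  | matched c r w w' hc hr hw _ ih ih' =>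
    rintro (_ | ⟨b, v⟩) hv
    · simp [numCalls, numRets]
    · obtain ⟨rfl, hv'⟩ := List.cons_prefix_cons.1 hv
      rw [(num_cons_call hc v).1, (num_cons_call hc v).2]
      obtain ⟨z, hz⟩ := hv'
      rcases List.append_eq_append_iff.1 hz with ⟨x, hx, -⟩ | ⟨x, rfl, hx⟩
      · have := ih v ⟨x, hx.symm⟩; omega
      · rw [numCalls_append, numRets_append, hw.num_eq]
        rcases x with _ | ⟨d, x⟩
        · simp [numCalls, numRets]
        · obtain ⟨rfl, hx'⟩ := List.cons_eq_cons.1 hx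
          rw [(num_cons_ret hr x).1, (num_cons_ret hr x).2]
          have := ih' x ⟨z, hx'.symm⟩
          omega

/-- If `m` came before `j`, the well-matched factor up to `m` followed by the return at `m` would be
a prefix of the factor up to `j` with more returns than calls. -/
theorem MatchingReturn.le {σ : List (Letter k)} {i j m : Fin σ.length}
    (hj : MatchingReturn σ i j) (hm : MatchingReturn σ i m) : j ≤ m := by
  by_contra hlt
  have hlt : (m : ℕ) < j := not_le.1 hlt
  obtain ⟨-, hr, him, hw⟩ := hm
  have him : (i : ℕ) < m := him
  have hpre : (σ.take m).drop (i + 1) ++ [σ.get m] <+: (σ.take j).drop (i + 1) := by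
    have h1 : (σ.take m).drop (i + 1) ++ [σ.get m] = (σ.take (m + 1)).drop (i + 1) := by
      rw [List.take_add_one, List.drop_append_of_le_length (by simp; omega)]
      simp
    rw [h1]
    refine List.IsPrefix.drop ?_ _
    exact List.take_prefix_take_left (by omega)
  have := hj.2.2.2.num_le _ hpre
  rw [numCalls_append, numRets_append, hw.num_eq, (num_cons_ret hr []).1,
    (num_cons_ret hr []).2] at this
  simp [numCalls, numRets] at this

theorem AbsSucc.lt {σ : List (Letter k)} {i j : Fin σ.length} (h : AbsSucc σ i j) : i < j := by
  by_cases hc : IsCall (σ.get i).1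
  · exact (h.1 hc).2.2.1
  · exact Fin.lt_def.2 (by rw [(h.2 hc).1]; exact Nat.lt_succ_self _)

theorem reflTransGen_absSucc_le {σ : List (Letter k)} {i j : Fin σ.length}
    (h : Relation.ReflTransGen (AbsSucc σ) i j) : i ≤ j := by
  induction h with
  | refl => exact le_rfl
  | tail _ h ih => exact ih.trans h.lt.le

/-- Abstract successors lie strictly later, so the path positions after `i` are those reachable from
`i`. The first of them is the matching return, and uniqueness leaves no path position before it. -/
theorem holds_absNext {w : TimedWord k} {i : Fin w.letters.length} {φ : Formula k}
    (hi : IsCall (w.letters.get i).1) :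
    Holds w i φ.absNext ↔ ∃ j, MatchingReturn w.letters i j ∧ Holds w j φ := by
  simp only [Formula.absNext, Holds, FDir.pos, holds_bot]
  constructor
  · rintro ⟨j, hij, hj, hφ, -, hl⟩
    refine ⟨j, ?_, hφ⟩
    rcases hj with hj | hj
    · rcases Relation.ReflTransGen.cases_head hj with rfl | ⟨m, him, hmj⟩
      · exact absurd hij (lt_irrefl _)
      · rcases eq_or_lt_of_le (reflTransGen_absSucc_le hmj) with rfl | hlt
        · exact him.1 hi
        · exact (hl m him.lt hlt (.inl (.single him))).elim
    · exact absurd (reflTransGen_absSucc_le hj) (not_le.2 hij)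
  · rintro ⟨j, hj, hφ⟩
    have hs : AbsSucc w.letters i j := ⟨fun _ => hj, fun h => absurd hi h⟩
    refine ⟨j, hs.lt, .inl (.single hs), hφ, w.sub_mem_univ hs.lt.le, ?_⟩
    rintro l h1 h2 (hl | hl)
    · rcases Relation.ReflTransGen.cases_head hl with rfl | ⟨m, him, hml⟩
      · exact lt_irrefl _ h1
      · exact absurd ((hj.le (him.1 hi)).trans (reflTransGen_absSucc_le hml)) (not_le.2 h2)
    · exact absurd (reflTransGen_absSucc_le hl) (not_le.2 h1)

/-- A word of `n` calls, then internal actions, then `n` returns is well-matched. -/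
theorem wellMatched_of_blocks (n : ℕ) : ∀ X : List (Letter k), 2 * n ≤ X.length →
    (∀ i (h : i < X.length), i < n → IsCall X[i].1) →
    (∀ i (h : i < X.length), X.length ≤ i + n → IsRet X[i].1) →
    (∀ i (h : i < X.length), n ≤ i → i + n < X.length → IsInt X[i].1) → WellMatched X := by
  induction n with
  | zero =>
    intro X _ _ _ h
    induction X with
    | nil => exact .nil
    | cons a X ih =>
      refine .internal a X (h 0 (by simp) le_rfl (by simp)) (ih (by simp) (by simp) ?_ ?_)
      · intro i h1 h2; omega
      · intro i hi _ _
        have := h (i + 1) (by simpa using hi) (by simp) (by simpa using hi)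
        simpa using this
  | succ n ih =>
    intro X hlen hc hr hi
    match X, hlen, hc, hr, hi with
    | c :: Z, hlen, hc, hr, hi =>
      rcases List.eq_nil_or_concat Z with rfl | ⟨Y, r, rfl⟩
      · simp at hlen; omega
      · simp only [List.concat_eq_append] at *
        simp only [List.length_cons, List.length_append, List.length_nil] at hlen hc hr hi
        refine .matched c r Y [] (hc 0 (by omega) (by omega)) ?_ (ih Y (by omega) ?_ ?_ ?_) .nil
        · have := hr (Y.length + 1) (by omega) (by omega)
          simpa using this
        · intro i h1 h2
          have := hc (i + 1) (by omega) (by omega)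
          simpa [h1] using this
        · intro i h1 h2
          have := hr (i + 1) (by omega) (by omega)
          simpa [h1] using this
        · intro i h1 h2 h3
          have := hi (i + 1) (by omega) (by omega) (by omega)
          simpa [h1] using this

open Classical in
-- The positions satisfying `P` are closed downwards, so they form an initial segment whose length
-- is their number.
theorem lt_countP_iff {α : Type} {P : α → Prop} (l : List α)
    (h : ∀ i (hi : i + 1 < l.length), P l[i + 1] → P l[i]) (i : ℕ) (hi : i < l.length) :
    P l[i] ↔ i < l.countP (fun a => P a) := by
  induction l generalizing i with
  | nil => simp at hi
  | cons a l ih =>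
    have hl := ih fun i hi h' => by
      have := h (i + 1) (by simpa using hi)
      simp only [List.getElem_cons_succ] at this
      exact this h'
    by_cases ha : P a
    · rcases i with _ | i
      · simp [ha]
      · simp only [List.getElem_cons_succ, List.countP_cons, ha, decide_true, if_true]
        rw [hl i (by simpa using hi)]
        omega
    · have hz : ∀ j (hj : j < l.length), ¬ P l[j] := by
        intro j
        induction j with
        | zero =>
          intro hj h'
          exact ha (h 0 (by simpa using hj) h')
        | succ j ihj =>
          intro hj h'
          exact ihj (by omega) (h (j + 1) (by simpa using hj) h')
      have hz' : l.countP (fun a => P a) = 0 := by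
        rw [List.countP_eq_zero]
        intro b hb
        obtain ⟨j, hj, rfl⟩ := List.mem_iff_getElem.1 hb
        simpa using hz j hj
      rcases i with _ | i
      · simp [ha, hz']
      · simp only [List.getElem_cons_succ, List.countP_cons, ha, hz']
        simp [hz i (by simpa using hi)]

end Matching

/-! ### Timed words that carry a sequence of tiles -/

section Frame

variable {k : ℕ} {T : Type} (e : T ≃ Fin k)

/-- The word `w` carries the tiles `u`, its first `L` positions are the calls, its last `L`
positions are the returns, and the positions at distance one are those that differ by `L`. -/
structure Carries (w : TimedWord k) (L : ℕ) (u : List T) : Prop where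
  length_eq : u.length = w.letters.length
  pos : 0 < L
  two_mul_le : 2 * L ≤ w.letters.length
  tile : ∀ (i : Fin w.letters.length) t,
    AP.user (e t) ∈ (w.letters.get i).1 ↔ u[(i : ℕ)]? = some t
  call : ∀ i : Fin w.letters.length, AP.call ∈ (w.letters.get i).1 ↔ (i : ℕ) < L
  ret : ∀ i : Fin w.letters.length,
    AP.ret ∈ (w.letters.get i).1 ↔ w.letters.length ≤ (i : ℕ) + L
  time : ∀ i j : Fin w.letters.length, w.time j = w.time i + 1 ↔ (j : ℕ) = i + L

/-- The proposition of a tile. -/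
def tileAtom (t : T) : Formula k := .atom (.user (e t))

/-- The formula saying that a word carries a sequence of tiles. -/
noncomputable def frame : Formula k :=
  have : Finite T := Finite.of_equiv _ e.symm
  .conj [.never .simultaneous,
    .never (.anyOf (fun p : T × T => p.1 ≠ p.2) fun p => (tileAtom e p.1).and (tileAtom e p.2)),
    .never (.neg (.anyOf (fun _ : T => True) (tileAtom e))),
    .never (.and (.neg (.atom .ret)) (.neg (.after (.neg (.atom .call))))),
    .never (.and (.neg (.atom .call)) (.next (.atom .call))),
    .never (.and (.atom .ret) (.next (.neg (.atom .ret)))),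
    .and (.atom .call) (.absNext (.and (.atom .ret) (.neg (.next .top))))]

theorem frame_isFutureAbsNext : (frame e).IsFutureAbsNext := by
  have : Finite T := Finite.of_equiv _ e.symm
  refine isFutureAbsNext_conj ?_
  simp only [List.forall_mem_cons]
  refine ⟨?_, ?_, ?_, ?_, ?_, ?_, ?_, by simp⟩
  · simp [Formula.never, Formula.eventually, Formula.simultaneous, Formula.bot,
      Formula.IsFutureAbsNext]
  · have h : (Formula.anyOf (fun p : T × T => p.1 ≠ p.2)
        fun p => (tileAtom e p.1).and (tileAtom e p.2)).IsFutureAbsNext :=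
      isFutureAbsNext_anyOf fun _ => ⟨trivial, trivial⟩
    exact ⟨h, trivial, h⟩
  · have h : (Formula.anyOf (fun _ : T => True) (tileAtom e)).IsFutureAbsNext :=
      isFutureAbsNext_anyOf fun _ => trivial
    exact ⟨h, trivial, h⟩
  all_goals simp [Formula.never, Formula.eventually, Formula.after, Formula.bot, Formula.and,
      Formula.next, Formula.absNext, Formula.IsFutureAbsNext]

/-- The meaning of `frame`. -/
theorem holds_frame {w : TimedWord k} {h0 : 0 < w.letters.length} :
    Holds w ⟨0, h0⟩ (frame e) ↔
      (∀ i (h : i + 1 < w.letters.length), w.time ⟨i + 1, h⟩ ≠ w.time ⟨i, by omega⟩) ∧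
      (∀ i s t, s ≠ t → AP.user (e s) ∈ (w.letters.get i).1 →
        AP.user (e t) ∉ (w.letters.get i).1) ∧
      (∀ i, ∃ t, AP.user (e t) ∈ (w.letters.get i).1) ∧
      (∀ i, AP.ret ∉ (w.letters.get i).1 →
        ∃ j, w.time j = w.time i + 1 ∧ AP.call ∉ (w.letters.get j).1) ∧
      (∀ i (h : i + 1 < w.letters.length), AP.call ∈ w.letters[i + 1].1 →
        AP.call ∈ w.letters[i].1) ∧
      (∀ i (h : i + 1 < w.letters.length), AP.ret ∈ w.letters[i].1 →
        AP.ret ∈ w.letters[i + 1].1) ∧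
      IsCall (w.letters.get ⟨0, h0⟩).1 ∧
      ∃ j, MatchingReturn w.letters ⟨0, h0⟩ j ∧ w.letters.length = j + 1 := by
  have : Finite T := Finite.of_equiv _ e.symm
  simp only [frame, holds_conj, List.forall_mem_cons]
  refine and_congr ?_ (and_congr ?_ (and_congr ?_ (and_congr ?_ (and_congr ?_
    (and_congr ?_ ?_)))))
  · simp only [holds_never, holds_simultaneous, not_exists]
    exact ⟨fun H i h => H ⟨i, by omega⟩ h, fun H i h => H i h⟩
  · simp only [holds_never, holds_anyOf, tileAtom, holds_and, holds_atom, Prod.exists, not_exists,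
      not_and]
  · simp [holds_never, holds_anyOf, tileAtom]
  · simp [holds_never, holds_after]
  · simp only [holds_never, holds_and, holds_neg, holds_next, holds_atom, not_and, not_exists]
    refine ⟨fun H i h hc => ?_, fun H i hi h hc => hi (H i h hc)⟩
    by_contra hn
    exact H ⟨i, by omega⟩ hn h hc
  · simp only [holds_never, holds_and, holds_neg, holds_next, holds_atom, not_and, not_exists,
      not_not]
    exact ⟨fun H i h hc => H ⟨i, by omega⟩ hc h, fun H i hi h => H i h hi⟩
  · simp only [holds_and, holds_atom, List.not_mem_nil, false_implies, implies_true, and_true,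
      ← Letter.isCall_iff]
    refine and_congr_right fun hc => ?_
    rw [holds_absNext hc]
    refine exists_congr fun j => and_congr_right fun hj => ?_
    simp only [holds_and, holds_neg, holds_atom, holds_next, holds_top, exists_prop, and_true,
      ← Letter.isRet_iff]
    have := j.2
    exact ⟨fun h => by omega, fun h => ⟨hj.2.1, by omega⟩⟩

/-- The `m` values lie in the interval from `L` to `m + L - 1`, which has only `m` elements. Upward
induction bounds `f` from below, downward induction from above. This is the counting step that
excludes extra positions. -/
theorem eq_add_of_strictMono {f : ℕ → ℕ} {m L : ℕ} (h1 : ∀ p, p < m → L ≤ f p)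
    (h2 : ∀ p, p < m → f p < m + L) (h3 : ∀ p q, p < q → q < m → f p < f q) (p : ℕ) (hp : p < m) :
    f p = p + L := by
  have lower : ∀ p, p < m → p + L ≤ f p := by
    intro p
    induction p with
    | zero => intro hp; simpa using h1 0 hp
    | succ p ih =>
      intro hp
      have := ih (by omega)
      have := h3 p (p + 1) (by omega) hp
      omega
  have upper : ∀ d p, p + d + 1 = m → f p ≤ p + L := by
    intro d
    induction d with
    | zero => intro p hp; have := h2 p (by omega); omega
    | succ d ih =>
      intro p hp
      have := ih (p + 1) (by omega)
      have := h3 p (p + 1) (by omega) (by omega)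
      omega
  exact le_antisymm (upper (m - p - 1) p (by omega)) (lower p hp)

/-- `L` is the number of calls. The word is a call, a well-matched factor and a return, so it is
also the number of returns; the closure conditions make the calls an initial and the returns a final
block. -/
theorem exists_blocks {σ : List (Letter k)} (h0 : 0 < σ.length)
    (hcall : ∀ i (h : i + 1 < σ.length), AP.call ∈ σ[i + 1].1 → AP.call ∈ σ[i].1)
    (hret : ∀ i (h : i + 1 < σ.length), AP.ret ∈ σ[i].1 → AP.ret ∈ σ[i + 1].1)
    (hc0 : IsCall (σ.get ⟨0, h0⟩).1) {j : Fin σ.length} (hj : MatchingReturn σ ⟨0, h0⟩ j)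
    (hjlast : σ.length = j + 1) :
    ∃ L, 0 < L ∧ 2 * L ≤ σ.length ∧
      (∀ i : Fin σ.length, AP.call ∈ (σ.get i).1 ↔ (i : ℕ) < L) ∧
      (∀ i : Fin σ.length, AP.ret ∈ (σ.get i).1 ↔ σ.length ≤ (i : ℕ) + L) := by
  classical
  have hj0 : (0 : ℕ) < j := hj.2.2.1
  have hσeq : σ = σ.get ⟨0, h0⟩ :: (σ.take j).drop 1 ++ [σ.get j] := by
    have h1 : σ.take (j + 1) = σ := List.take_of_length_le (by omega)
    have h2 : σ.take j = σ.get ⟨0, h0⟩ :: (σ.take j).drop 1 := by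
      obtain ⟨m, hm⟩ : ∃ m, (j : ℕ) = m + 1 := ⟨j - 1, by omega⟩
      rw [hm]
      cases σ with
      | nil => simp at h0
      | cons a σ => simp
    rw [← h2]
    conv_lhs => rw [← h1, List.take_add_one]
    simp
  have hnum : numCalls σ = numRets σ := by
    rw [hσeq, numCalls_append, numRets_append, (num_cons_call hc0 _).1, (num_cons_call hc0 _).2,
      (num_cons_ret hj.2.1 _).1, (num_cons_ret hj.2.1 _).2]
    have h1 : numCalls ((σ.take j).drop 1) = numRets ((σ.take j).drop 1) := hj.2.2.2.num_eq
    rw [h1]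
    simp [numCalls, numRets]
  have hcalls : ∀ i : Fin σ.length, AP.call ∈ (σ.get i).1 ↔ (i : ℕ) < numCalls σ := by
    intro i
    rw [← Letter.isCall_iff]
    refine lt_countP_iff (P := fun a : Letter k => IsCall a.1) σ ?_ i i.2
    intro i hi
    simp only [Letter.isCall_iff]
    exact hcall i hi
  have hcount : σ.countP (fun a => ¬ IsRet a.1) + numRets σ = σ.length := by
    have := List.length_eq_countP_add_countP (fun a : Letter k => decide (IsRet a.1)) (l := σ)
    simp only [decide_eq_true_eq] at this
    rw [numRets, this, add_comm]
  have hrets : ∀ i : Fin σ.length, AP.ret ∈ (σ.get i).1 ↔ σ.length ≤ (i : ℕ) + numCalls σ := by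
    intro i
    have h1 : ¬ IsRet (σ.get i).1 ↔ (i : ℕ) < σ.countP (fun a => ¬ IsRet a.1) := by
      rw [List.get_eq_getElem]
      have := lt_countP_iff (P := fun a : Letter k => ¬ IsRet a.1) σ (by
        intro i hi
        simp only [Letter.isRet_iff]
        exact fun h h' => h (hret i hi h')) i i.2
      convert this
    rw [← Letter.isRet_iff, ← not_iff_not, h1]
    omega
  refine ⟨numCalls σ, (hcalls ⟨0, h0⟩).1 ((Letter.isCall_iff _).1 hc0), ?_, hcalls, hrets⟩
  by_contra hlt
  have hle : numCalls σ ≤ σ.length := List.countP_le_length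
  have hpos := (hcalls ⟨0, h0⟩).1 ((Letter.isCall_iff _).1 hc0)
  simp only at hpos
  -- If the blocks overlapped, the first return would also be a call.
  have h1 := (hrets ⟨σ.length - numCalls σ, by omega⟩).2 (by simp; omega)
  have h2 := (hcalls ⟨σ.length - numCalls σ, by omega⟩).2 (by simp; omega)
  rw [← Letter.isCall_iff] at h2
  rw [← Letter.isRet_iff] at h1
  exact not_isRet_of_isCall h2 h1

theorem exists_carries {w : TimedWord k} {h0 : 0 < w.letters.length}
    (h : Holds w ⟨0, h0⟩ (frame e)) : ∃ L u, Carries e w L u := by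
  obtain ⟨hstrict, huniq, hex, hshift, hcall, hret, hc0, j, hj, hjlast⟩ := (holds_frame e).1 h
  have hmono : StrictMono w.time := by
    intro a b hab
    have hab : (a : ℕ) < b := hab
    have h1 : (a : ℕ) + 1 < w.letters.length := by omega
    have h2 : w.time a ≤ w.time ⟨a + 1, h1⟩ := w.mono (Nat.le_succ _)
    have h3 : w.time ⟨a + 1, h1⟩ ≤ w.time b := w.mono (Fin.le_def.2 (by simpa using hab))
    exact (lt_of_le_of_ne h2 (hstrict a h1).symm).trans_le h3
  choose tile htile using hex
  obtain ⟨L, hLpos, h2L, hcalls, hrets⟩ := exists_blocks h0 hcall hret hc0 hj hjlast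
  have hf : ∀ p, ∃ q, ∀ hp : p < w.letters.length - L, ∃ hq : q < w.letters.length,
      w.time ⟨q, hq⟩ = w.time ⟨p, by omega⟩ + 1 ∧ L ≤ q := by
    intro p
    by_cases hp : p < w.letters.length - L
    · obtain ⟨q, hq1, hq2⟩ := hshift ⟨p, by omega⟩ (by rw [hrets]; simp; omega)
      rw [hcalls] at hq2
      exact ⟨q, fun _ => ⟨q.2, hq1, by omega⟩⟩
    · exact ⟨0, fun h => absurd h hp⟩
  choose f hf using hf
  have hfeq : ∀ p, p < w.letters.length - L → f p = p + L := by
    refine eq_add_of_strictMono (fun p hp => (hf p hp).2.2) (fun p hp => ?_) (fun p q hpq hq => ?_)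
    · have := (hf p hp).1; omega
    · obtain ⟨a1, a2, -⟩ := hf p (by omega)
      obtain ⟨b1, b2, -⟩ := hf q hq
      have h1 : w.time ⟨p, by omega⟩ < w.time ⟨q, by omega⟩ := hmono hpq
      have h2 : w.time ⟨f p, a1⟩ < w.time ⟨f q, b1⟩ := by
        rw [a2, b2]
        exact add_lt_add_left h1 1
      exact hmono.lt_iff_lt.1 h2
  have htime : ∀ p (hp : p + L < w.letters.length), w.time ⟨p + L, hp⟩ = w.time ⟨p, by omega⟩ + 1 := by
    intro p hp
    obtain ⟨a1, a2, -⟩ := hf p (by omega)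
    rw [← a2]
    congr 2
    exact (hfeq p (by omega)).symm
  refine ⟨L, List.ofFn tile, by simp, hLpos, h2L, ?_, hcalls, hrets, ?_⟩
  · intro i t
    have : (List.ofFn tile)[(i : ℕ)]? = some (tile i) := by simp
    rw [this, Option.some.injEq]
    constructor
    · intro ht
      by_contra hne
      exact huniq i _ _ hne (htile i) ht
    · rintro rfl
      exact htile i
  · intro i j'
    constructor
    · intro hij
      by_cases hi : (i : ℕ) + L < w.letters.length
      · rw [← htime i hi] at hij
        exact congrArg Fin.val (hmono.injective hij)
      -- Here `i` is a return, and a position `j'` one unit later would also be one unit after `j' -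
      -- L`. Strict monotonicity then gives `i = j' - L`, so `j'` lies beyond the end of the word.
      · have hlt : i < j' := by
          rw [← hmono.lt_iff_lt, hij]
          simp
        have hlt : (i : ℕ) < j' := hlt
        have h1 := htime (j' - L) (by omega)
        have h2 : (⟨j' - L + L, by omega⟩ : Fin w.letters.length) = j' := Fin.ext (by simp; omega)
        rw [h2, hij, add_left_inj] at h1
        have := congrArg Fin.val (hmono.injective h1)
        simp at this
        omega
    · intro hij
      have h2 : (⟨i + L, by omega⟩ : Fin w.letters.length) = j' := Fin.ext hij.symm
      rw [← h2]
      exact htime i _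

/-- The letter with the propositions `s` and `p`. -/
def mkLetter (s : AP k) (n : Fin k) (hs : s ∈ ({.call, .ret, .intA} : Set (AP k))) : Letter k :=
  ⟨{s, .user n}, by
    have key : ({s, .user n} ∩ {.call, .ret, .intA} : Set (AP k)) = {s} := by
      ext x
      simp only [Set.mem_inter_iff, Set.mem_insert_iff, Set.mem_singleton_iff] at hs ⊢
      constructor
      · rintro ⟨rfl | rfl, h⟩
        · rfl
        · simp at h
      · rintro rfl
        exact ⟨.inl rfl, hs⟩
    simp only [IsCall, IsRet, IsInt, key]
    rcases hs with rfl | rfl | rfl <;> simp⟩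

/-- The special proposition at position `p` of a word of length `N` with `L` calls. -/
def kind (k N L p : ℕ) : AP k := if p < L then .call else if N ≤ p + L then .ret else .intA

theorem kind_mem (N L p : ℕ) : kind k N L p ∈ ({.call, .ret, .intA} : Set (AP k)) := by
  unfold kind
  split_ifs <;> simp

/-- A timed word that carries the tiles `u`. -/
noncomputable def carrier (L : ℕ) (u : List T) : TimedWord k where
  letters := List.ofFn fun p : Fin u.length =>
    mkLetter (kind k u.length L p) (e u[p]) (kind_mem _ _ _)
  -- With spacing `1 / L`, positions are one time unit apart exactly when they differ by `L`.
  time p := (p : ℝ≥0) / L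
  mono p q h := by
    have : ((p : ℕ) : ℝ≥0) ≤ (q : ℕ) := Nat.cast_le.2 h
    exact div_le_div_of_nonneg_right this zero_le

theorem carries_carrier {L : ℕ} {u : List T} (hL : 0 < L) (hu : 2 * L ≤ u.length) :
    Carries e (carrier e L u) L u := by
  have hlen : (carrier e L u).letters.length = u.length := by simp [carrier]
  have hget : ∀ i : Fin (carrier e L u).letters.length, ((carrier e L u).letters.get i).1 =
      {kind k u.length L i, .user (e (u[(i : ℕ)]'(hlen ▸ i.2)))} := by
    intro i
    exact congrArg Subtype.val (List.get_ofFn _ i)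
  refine ⟨hlen.symm, hL, by omega, ?_, ?_, ?_, ?_⟩
  · intro i t
    rw [hget, List.getElem?_eq_getElem (hlen ▸ i.2)]
    simp only [Set.mem_insert_iff, Set.mem_singleton_iff, AP.user.injEq,
      EmbeddingLike.apply_eq_iff_eq, Option.some.injEq]
    have : AP.user (e t) ≠ kind k u.length L i := by
      unfold kind
      split_ifs <;> simp
    simp [this, eq_comm]
  · intro i
    rw [hget]
    simp only [Set.mem_insert_iff, Set.mem_singleton_iff, reduceCtorEq, or_false]
    unfold kind
    split_ifs with h1 h2 <;> simp [h1]
  · intro i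
    rw [hget]
    simp only [Set.mem_insert_iff, Set.mem_singleton_iff, reduceCtorEq, or_false]
    unfold kind
    split_ifs with h1 h2 <;> simp <;> omega
  · intro i j
    have hL' : (L : ℝ≥0) ≠ 0 := by exact_mod_cast hL.ne'
    change ((j : ℕ) : ℝ≥0) / L = ((i : ℕ) : ℝ≥0) / L + 1 ↔ _
    rw [div_add_one hL', div_left_inj' hL']
    exact_mod_cast Iff.rfl

/-- Without the first call and the last return, the word has blocks of `L - 1` calls and `L - 1`
returns around internal actions. -/
theorem Carries.wellMatched {w : TimedWord k} {L : ℕ} {u : List T} (h : Carries e w L u) :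
    WellMatched ((w.letters.take (w.letters.length - 1)).drop 1) := by
  obtain ⟨-, hpos, h2, -, hcall, hret, -⟩ := h
  have hX : ((w.letters.take (w.letters.length - 1)).drop 1).length = w.letters.length - 2 := by
    simp; omega
  have hcall' : ∀ i (hi : i < w.letters.length), IsCall w.letters[i].1 ↔ i < L := fun i hi => by
    rw [Letter.isCall_iff]; exact hcall ⟨i, hi⟩
  have hret' : ∀ i (hi : i < w.letters.length), IsRet w.letters[i].1 ↔ w.letters.length ≤ i + L :=
    fun i hi => by rw [Letter.isRet_iff]; exact hret ⟨i, hi⟩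
  refine wellMatched_of_blocks (L - 1) _ (by omega) ?_ ?_ ?_
  all_goals
    intro i hi
    rw [hX] at *
    simp only [List.getElem_drop, List.getElem_take]
  · intro h; exact (hcall' _ _).2 (by omega)
  · intro h; exact (hret' _ _).2 (by omega)
  · intro h1 h2
    refine Letter.isInt_of_not _ ?_ ?_
    · rw [hcall']; omega
    · rw [hret']; omega

theorem holds_frame_carrier {L : ℕ} {u : List T} (hL : 0 < L) (hu : 2 * L ≤ u.length)
    (h0 : 0 < (carrier e L u).letters.length) : Holds (carrier e L u) ⟨0, h0⟩ (frame e) := by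
  have hc := carries_carrier e hL hu
  obtain ⟨hlen, -, -, htile, hcall, hret, htime⟩ := hc
  have hL' : (L : ℝ≥0) ≠ 0 := by exact_mod_cast hL.ne'
  have hc0 : IsCall ((carrier e L u).letters.get ⟨0, h0⟩).1 := by
    rw [Letter.isCall_iff, hcall]; exact hL
  refine (holds_frame e).2 ⟨?_, ?_, ?_, ?_, ?_, ?_, hc0, ?_⟩
  · intro i h heq
    change ((i + 1 : ℕ) : ℝ≥0) / L = ((i : ℕ) : ℝ≥0) / L at heq
    rw [div_left_inj' hL'] at heq
    have : i + 1 = i := by exact_mod_cast heq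
    omega
  · intro i s t hst h1 h2
    rw [htile] at h1 h2
    rw [h1] at h2
    exact hst (Option.some.inj h2)
  · intro i
    exact ⟨u[(i : ℕ)]'(hlen.symm ▸ i.2), (htile _ _).2 (List.getElem?_eq_getElem _)⟩
  · intro i hi
    rw [hret] at hi
    refine ⟨⟨i + L, by omega⟩, (htime _ _).2 rfl, ?_⟩
    rw [hcall]
    simp
  · intro i h h1
    have := (hcall ⟨i + 1, h⟩).1 h1
    exact (hcall ⟨i, by omega⟩).2 (by simp at this ⊢; omega)
  · intro i h h1
    have := (hret ⟨i, by omega⟩).1 h1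
    exact (hret ⟨i + 1, h⟩).2 (by simp at this ⊢; omega)
  · refine ⟨⟨(carrier e L u).letters.length - 1, by omega⟩, ⟨hc0, ?_, ?_, ?_⟩, by simp; omega⟩
    · rw [Letter.isRet_iff, hret]
      simp; omega
    · rw [Fin.lt_def]
      simp; omega
    · exact (carries_carrier e hL hu).wellMatched e

end Frame

/-! ### Formulas that describe a helix -/

section Tiling

variable {k : ℕ} {A ι : Type} (e : Tile A ι ≃ Fin k) (lhs rhs : ι → Fin 3 → A)

/-- The tile has the letter `a`. -/
noncomputable def letterIs (a : A) : Formula k :=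
  have : Finite (Tile A ι) := Finite.of_equiv _ e.symm
  .anyOf (fun t => t.letter lhs = a) (tileAtom e)

/-- The formula saying that the tiles of a word form a helix that starts with the letter `b` and
contains the letter `c` before its last row. -/
noncomputable def tiling (b c : A) : Formula k :=
  have : Finite (Tile A ι) := Finite.of_equiv _ e.symm
  .conj [
    .never (.anyOf (fun p : Tile A ι × Tile A ι => ¬ Adjacent p.1 p.2)
      fun p => (tileAtom e p.1).and (.next (tileAtom e p.2))),
    .never (.anyOf (fun p : Tile A ι × Tile A ι => p.2.letter lhs ≠ p.1.letter rhs)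
      fun p => (tileAtom e p.1).and (.after (tileAtom e p.2))),
    tileAtom e (.inl b),
    .eventually (.and (.neg (.atom .ret)) (letterIs e lhs c))]

/-- A call position with the letter `a`. -/
noncomputable def callLetter (a : A) : Formula k := .and (.atom .call) (letterIs e lhs a)

/-- The rest of the first row consists of the letters `x` and copies of `b`. -/
noncomputable def rowTail (b : A) (x : List A) : Formula k :=
  x.foldr (fun a φ => .next ((callLetter e lhs a).and φ))
    (.untl .glob .univ (callLetter e lhs b) (.neg (.atom .call)))

/-- After its first letter, the first row consists of copies of `b`, the letter `q`, the letters
`x`, and copies of `b`. -/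
noncomputable def firstRow (b q : A) (x : List A) : Formula k :=
  .untl .glob .univ (callLetter e lhs b) ((callLetter e lhs q).and (rowTail e lhs b x))

theorem letterIs_isFutureAbsNext (a : A) : (letterIs e lhs a).IsFutureAbsNext := by
  have : Finite (Tile A ι) := Finite.of_equiv _ e.symm
  exact isFutureAbsNext_anyOf fun _ => trivial

theorem tiling_isFutureAbsNext (b c : A) : (tiling e lhs rhs b c).IsFutureAbsNext := by
  have : Finite (Tile A ι) := Finite.of_equiv _ e.symm
  refine isFutureAbsNext_conj ?_
  simp only [List.forall_mem_cons]
  have key : ∀ (P : Tile A ι × Tile A ι → Prop) (f : Tile A ι × Tile A ι → Formula k),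
      (∀ p, (f p).IsFutureAbsNext) → (Formula.anyOf P f).never.IsFutureAbsNext := by
    intro P f hf
    have h := isFutureAbsNext_anyOf (P := P) hf
    exact ⟨h, trivial, h⟩
  refine ⟨key _ _ fun _ => ?_, key _ _ fun _ => ?_, trivial, ?_, by simp⟩
  · exact ⟨trivial, trivial, trivial⟩
  · exact ⟨trivial, trivial, trivial⟩
  · have h := letterIs_isFutureAbsNext e lhs c
    exact ⟨⟨trivial, h⟩, trivial, trivial, h⟩

theorem firstRow_isFutureAbsNext (b q : A) (x : List A) :
    (firstRow e lhs b q x).IsFutureAbsNext := by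
  have hc : ∀ a, (callLetter e lhs a).IsFutureAbsNext := fun a =>
    ⟨trivial, letterIs_isFutureAbsNext e lhs a⟩
  refine ⟨hc _, hc _, ?_⟩
  induction x with
  | nil => exact ⟨hc _, trivial⟩
  | cons a x ih => exact ⟨trivial, hc _, ih⟩

variable {e lhs rhs} {w : TimedWord k} {L : ℕ} {u : List (Tile A ι)}

theorem Carries.holds_tileAtom (h : Carries e w L u) {i : Fin w.letters.length} {t : Tile A ι} :
    Holds w i (tileAtom e t) ↔ u[(i : ℕ)]? = some t := by
  rw [tileAtom, holds_atom, h.tile]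

theorem Carries.holds_letterIs (h : Carries e w L u) {i : Fin w.letters.length} {a : A} :
    Holds w i (letterIs e lhs a) ↔ (u.map (Tile.letter lhs))[(i : ℕ)]? = some a := by
  have : Finite (Tile A ι) := Finite.of_equiv _ e.symm
  simp only [letterIs, holds_anyOf, h.holds_tileAtom, List.getElem?_map, Option.map_eq_some_iff]
  exact exists_congr fun t => and_comm

/-- In a word that carries tiles, `after` means a shift by `L`, and not being a return means that a
tile `L` places later exists. -/
theorem Carries.holds_tiling (h : Carries e w L u) {h0 : 0 < w.letters.length} {b c : A} :
    Holds w ⟨0, h0⟩ (tiling e lhs rhs b c) ↔ IsHelix lhs rhs L u ∧ u[0]? = some (.inl b) ∧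
      ∃ p, ∃ h : p + L < u.length, u[p].letter lhs = c := by
  have : Finite (Tile A ι) := Finite.of_equiv _ e.symm
  have hlen := h.length_eq
  simp only [tiling, holds_conj, List.forall_mem_cons, List.not_mem_nil, false_implies,
    implies_true, and_true]
  have hadj : Holds w ⟨0, h0⟩ (.never (.anyOf
      (fun p : Tile A ι × Tile A ι => ¬ Adjacent p.1 p.2)
      fun p => (tileAtom e p.1).and (.next (tileAtom e p.2)))) ↔ u.IsChain Adjacent := by
    simp only [holds_never, holds_anyOf, holds_and, holds_next, h.holds_tileAtom,
      List.isChain_iff_getElem]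
    constructor
    · intro H i hi
      by_contra hn
      exact H ⟨i, by omega⟩ ⟨(u[i], u[i + 1]), hn, by simp, by simp; omega⟩
    · rintro H j ⟨⟨t, t'⟩, hn, h1, h2, h3⟩
      obtain ⟨h4, rfl⟩ := List.getElem?_eq_some_iff.1 h1
      obtain ⟨h5, rfl⟩ := List.getElem?_eq_some_iff.1 h3
      exact hn (H j h5)
  have hnext : Holds w ⟨0, h0⟩ (.never (.anyOf
      (fun p : Tile A ι × Tile A ι => p.2.letter lhs ≠ p.1.letter rhs)
      fun p => (tileAtom e p.1).and (.after (tileAtom e p.2)))) ↔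
      ∀ p (h : p + L < u.length), u[p + L].letter lhs = u[p].letter rhs := by
    simp only [holds_never, holds_anyOf, holds_and, holds_after, h.holds_tileAtom, h.time]
    constructor
    · intro H i hi
      by_contra hn
      exact H ⟨i, by omega⟩ ⟨(u[i], u[i + L]), hn, by simp, ⟨i + L, by omega⟩, rfl, by simp⟩
    · rintro H j ⟨⟨t, t'⟩, hn, h1, j', h2, h3⟩
      obtain ⟨h4, rfl⟩ := List.getElem?_eq_some_iff.1 h1
      simp only [h2] at h3
      obtain ⟨h5, rfl⟩ := List.getElem?_eq_some_iff.1 h3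
      exact hn (H j h5)
  have hex : Holds w ⟨0, h0⟩ (.eventually (.and (.neg (.atom .ret)) (letterIs e lhs c))) ↔
      ∃ p, ∃ h : p + L < u.length, u[p].letter lhs = c := by
    simp only [holds_eventually, holds_and, holds_neg, holds_atom, h.ret, h.holds_letterIs]
    constructor
    · rintro ⟨j, -, h1, h2⟩
      refine ⟨j, by omega, ?_⟩
      obtain ⟨h3, h4⟩ := List.getElem?_eq_some_iff.1 h2
      simpa using h4
    · rintro ⟨p, hp, hc⟩
      refine ⟨⟨p, by omega⟩, Nat.zero_le _, by simp; omega, ?_⟩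
      rw [List.getElem?_eq_getElem (by simp; omega)]
      simp [hc]
  rw [hadj, hnext, hex, h.holds_tileAtom]
  constructor
  · rintro ⟨h1, h2, h3⟩
    exact ⟨⟨h1, h2⟩, h3⟩
  · rintro ⟨⟨h1, h2⟩, h3⟩
    exact ⟨h1, h2, h3⟩

theorem Carries.holds_callLetter (h : Carries e w L u) {i : Fin w.letters.length} {a : A} :
    Holds w i (callLetter e lhs a) ↔ ((u.take L).map (Tile.letter lhs))[(i : ℕ)]? = some a := by
  rw [callLetter, holds_and, holds_atom, h.call, h.holds_letterIs, List.map_take,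
    List.getElem?_take]
  split_ifs with hi <;> simp [hi]

/-- The calls are exactly the first row, so `callLetter` cannot look past it and the closing until
stops no earlier than its end. -/
theorem Carries.holds_rowTail (h : Carries e w L u) (b : A) (x : List A)
    (i : Fin w.letters.length) (hi : (i : ℕ) < L) :
    Holds w i (rowTail e lhs b x) ↔
      ∃ j, ((u.take L).map (Tile.letter lhs)).drop (i + 1) = x ++ List.replicate j b := by
  have hVlen : ((u.take L).map (Tile.letter lhs)).length = L := by
    have := h.length_eq
    have := h.two_mul_le
    simp; omega
  have h2L := h.two_mul_le
  induction x generalizing i with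
  | nil =>
    have e1 : rowTail e lhs b [] =
      .untl .glob .univ (callLetter e lhs b) (.neg (.atom .call)) := rfl
    simp only [e1, holds_untl_univ, holds_neg, holds_atom, h.call, h.holds_callLetter, not_lt,
      List.nil_append]
    generalize (u.take L).map (Tile.letter lhs) = V at *
    constructor
    · rintro ⟨q, -, h2, h3⟩
      refine ⟨L - (i + 1), List.eq_replicate_iff.2 ⟨by simp [hVlen], ?_⟩⟩
      intro a ha
      obtain ⟨m, hm, rfl⟩ := List.mem_iff_getElem.1 ha
      simp only [List.length_drop, hVlen] at hm
      have := h3 ⟨i + 1 + m, by omega⟩ (Fin.lt_def.2 (by simp; omega))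
        (Fin.lt_def.2 (by simp; omega))
      rw [List.getElem?_eq_getElem (by simp; omega), Option.some.injEq] at this
      simpa using this
    · rintro ⟨j, hj⟩
      -- Position `L`, the first that is not a call, exists because `2 * L` is at most the length.
      refine ⟨⟨L, by omega⟩, Fin.lt_def.2 (by simpa using hi), le_rfl, ?_⟩
      intro l h1 h2
      have h1 : (i : ℕ) < l := h1
      have h2 : (l : ℕ) < L := h2
      have hjl := congrArg List.length hj
      simp only [List.length_drop, hVlen, List.length_replicate] at hjl
      have := congrArg (fun X => X[(l : ℕ) - (i + 1)]?) hj
      simp only [List.getElem?_drop, List.getElem?_replicate] at this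
      rw [if_pos (by omega)] at this
      rw [← this]
      congr 1
      omega
  | cons a x ih =>
    have e1 : rowTail e lhs b (a :: x) =
      .next ((callLetter e lhs a).and (rowTail e lhs b x)) := rfl
    simp only [e1, holds_next, holds_and, h.holds_callLetter]
    constructor
    · rintro ⟨h1, h2, h3⟩
      obtain ⟨h4, h5⟩ := List.getElem?_eq_some_iff.1 h2
      rw [hVlen] at h4
      obtain ⟨j, hj⟩ := (ih ⟨i + 1, h1⟩ h4).1 h3
      refine ⟨j, ?_⟩
      rw [List.drop_eq_getElem_cons (by omega), h5]
      exact congrArg (a :: ·) hj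
    · rintro ⟨j, hj⟩
      have h4 : (i : ℕ) + 1 < L := by
        have := congrArg List.length hj
        rw [List.length_drop, hVlen] at this
        simp at this
        omega
      rw [List.drop_eq_getElem_cons (by omega)] at hj
      obtain ⟨h5, h6⟩ := List.cons_eq_cons.1 hj
      have h1 : (i : ℕ) + 1 < w.letters.length := by omega
      exact ⟨h1, List.getElem?_eq_some_iff.2 ⟨_, h5⟩, (ih ⟨i + 1, h1⟩ h4).2 ⟨j, h6⟩⟩

theorem Carries.holds_firstRow (h : Carries e w L u) {h0 : 0 < w.letters.length} (b q : A)
    (x : List A) : Holds w ⟨0, h0⟩ (firstRow e lhs b q x) ↔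
      ∃ i j, ((u.take L).map (Tile.letter lhs)).drop 1 =
        List.replicate i b ++ q :: (x ++ List.replicate j b) := by
  have hVlen : ((u.take L).map (Tile.letter lhs)).length = L := by
    have := h.length_eq
    have := h.two_mul_le
    simp; omega
  have h2L := h.two_mul_le
  simp only [firstRow, holds_untl_univ, holds_and, h.holds_callLetter]
  constructor
  · rintro ⟨p, hp, ⟨h1, h2⟩, h3⟩
    have hp : 0 < (p : ℕ) := hp
    obtain ⟨h4, h5⟩ := List.getElem?_eq_some_iff.1 h1
    rw [hVlen] at h4
    obtain ⟨j, hj⟩ := (h.holds_rowTail b x p h4).1 h2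
    -- Position 0 holds the border, so a state letter at position `p` has `p - 1` blanks before it.
    refine ⟨p - 1, j, ?_⟩
    rw [← hj]
    generalize (u.take L).map (Tile.letter lhs) = V at *
    rw [← h5, ← List.drop_eq_getElem_cons]
    have e1 : V.drop 1 = (V.drop 1).take (p - 1) ++ V.drop p := by
      conv_lhs => rw [← List.take_append_drop (p - 1) (V.drop 1)]
      rw [List.drop_drop]
      congr 2
      omega
    rw [e1]
    congr 1
    refine List.eq_replicate_iff.2 ⟨by simp; omega, ?_⟩
    intro a ha
    obtain ⟨m, hm, rfl⟩ := List.mem_iff_getElem.1 ha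
    simp only [List.length_take, List.length_drop, hVlen] at hm
    have := h3 ⟨1 + m, by omega⟩ (Fin.lt_def.2 (by simp)) (Fin.lt_def.2 (by simp; omega))
    rw [List.getElem?_eq_getElem (by simp; omega), Option.some.injEq] at this
    simpa [add_comm] using this
  · rintro ⟨i, j, hij⟩
    have hlen := congrArg List.length hij
    rw [List.length_drop, hVlen] at hlen
    simp only [List.length_append, List.length_replicate, List.length_cons] at hlen
    have hget : ∀ m, ((u.take L).map (Tile.letter lhs))[1 + m]? =
        (List.replicate i b ++ q :: (x ++ List.replicate j b))[m]? := by
      intro m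
      rw [← hij, List.getElem?_drop]
    refine ⟨⟨1 + i, by omega⟩, Fin.lt_def.2 (by simp), ⟨?_, ?_⟩, ?_⟩
    · rw [hget]
      simp
    · refine (h.holds_rowTail b x ⟨1 + i, by omega⟩ (by simp; omega)).2 ⟨j, ?_⟩
      have := congrArg (List.drop (i + 1)) hij
      rw [List.drop_drop] at this
      have e1 : (1 + i + 1 : ℕ) = 1 + (i + 1) := by omega
      simp only [e1, this]
      rw [List.drop_append]
      simp
    · intro l h1 h2
      have h1 : 0 < (l : ℕ) := h1
      have h2 : (l : ℕ) < 1 + i := h2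
      have e1 : (l : ℕ) = 1 + (l - 1) := by omega
      rw [e1, hget, List.getElem?_append_left (by simp; omega), List.getElem?_replicate,
        if_pos (by omega)]

end Tiling

/-! ### The reduction -/

section Reduction

open Turing ConfLetter

variable {k : ℕ} {Γ Λ : Type} [Inhabited Γ] [Inhabited Λ]
  (e : Tile (ConfLetter Γ Λ) (Γ × Λ × Γ) ≃ Fin k) (M : TM0.Machine Γ Λ)

/-- A formula that is satisfiable iff the machine halts on the input. -/
noncomputable def haltingFormula (input : List Γ) : Formula k :=
  .and (.and (frame e) (tiling e ruleLhs (ruleRhs M) none (state none)))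
    (firstRow e ruleLhs (cell default) (state (some default)) (input.map cell))

theorem haltingFormula_isFutureAbsNext (input : List Γ) :
    (haltingFormula e M input).IsFutureAbsNext :=
  ⟨⟨frame_isFutureAbsNext e, tiling_isFutureAbsNext _ _ _ _ _⟩,
    firstRow_isFutureAbsNext _ _ _ _ _⟩

theorem initWord_eq (input : List Γ) (i j : ℕ) :
    initWord Λ input i j = none :: (List.replicate i (cell default) ++
      state (some default) :: (input.map cell ++ List.replicate j (cell default))) := by
  simp [initWord, confWord]

theorem haltingFormula_satisfiable_iff (input : List Γ) :
    (haltingFormula e M input).Satisfiable ↔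
      (StateTransition.eval (TM0.step M) (TM0.init input)).Dom := by
  rw [eval_dom_iff_rewrites]
  constructor
  · rintro ⟨w, h0, hw⟩
    rw [haltingFormula, holds_and, holds_and] at hw
    obtain ⟨⟨hf, ht⟩, hr⟩ := hw
    obtain ⟨L, u, hc⟩ := exists_carries e hf
    obtain ⟨hu, hu0, p, hp, hpc⟩ := hc.holds_tiling.1 ht
    obtain ⟨i, j, hij⟩ := (hc.holds_firstRow _ _ _).1 hr
    have hL := hc.pos
    -- The halting letter at `p` lies in row `p / L`, which is complete because `p + L` is still
    -- inside the word. An incomplete last row does no harm.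
    have hdiv : p / L * L ≤ p := Nat.div_mul_le_self p L
    have hmod : p - p / L * L < L := by
      have h1 := Nat.div_add_mod p L
      have h2 := Nat.mod_lt p hL
      rw [mul_comm] at h1
      omega
    have hreach := hu.reaches_row hL ruleLhs_ne_none hu0 (p / L) (by
      have : (p / L + 1) * L = p / L * L + L := by ring
      omega)
    refine ⟨i, j, (row L u (p / L)).map (Tile.letter ruleLhs), ?_, ?_⟩
    · convert hreach using 1
      rw [initWord_eq, ← hij]
      simp only [row, zero_mul, List.drop_zero]
      rcases u with _ | ⟨t, u⟩
      · simp at hu0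
      · obtain rfl : t = .inl none := by simpa using hu0
        obtain ⟨L, rfl⟩ : ∃ L', L = L' + 1 := ⟨L - 1, by omega⟩
        simp [Tile.letter]
    · rw [← hpc]
      refine List.mem_map_of_mem ?_
      refine List.mem_iff_getElem.2 ⟨p - p / L * L, by simp [row]; omega, ?_⟩
      simp only [row, List.getElem_take, List.getElem_drop]
      congr 1
      omega
  · rintro ⟨i, j, W, hW, hm⟩
    have hhead : (initWord Λ input i j).head? = some none := by simp [initWord_eq]
    obtain ⟨u, hu, htake, hlen, hu0, hmem⟩ := exists_isHelix ruleLhs_ne_none hW hhead rfl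
    have hL : 0 < (initWord Λ input i j).length := by simp [initWord_eq]
    have hc := carries_carrier e hL hlen
    have h0 : 0 < (carrier e (initWord Λ input i j).length u).letters.length := by
      rw [← hc.length_eq]; omega
    refine ⟨_, h0, ?_⟩
    rw [haltingFormula, holds_and, holds_and]
    refine ⟨⟨holds_frame_carrier e hL hlen h0, hc.holds_tiling.2 ⟨hu, hu0, hmem _ hm⟩⟩,
      (hc.holds_firstRow _ _ _).2 ⟨i, j, ?_⟩⟩
    rw [htake, initWord_eq]
    simp

/-! ### Computability of the reduction -/

/-- The code of a conjunction. -/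
def codeAnd (m n : ℕ) : ℕ := Nat.pair 3 (Nat.pair 2 (Nat.pair (Nat.pair 3 m) (Nat.pair 3 n)))

theorem codeAnd_primrec : Primrec₂ codeAnd := by
  unfold codeAnd
  refine Primrec₂.natPair.comp (Primrec.const _) (Primrec₂.natPair.comp (Primrec.const _)
    (Primrec₂.natPair.comp ?_ ?_))
  · exact Primrec₂.natPair.comp (Primrec.const _) Primrec.fst
  · exact Primrec₂.natPair.comp (Primrec.const _) Primrec.snd

theorem code_and (φ ψ : Formula k) : (φ.and ψ).code = codeAnd φ.code ψ.code := by
  simp only [Formula.and, Formula.code, codeAnd]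

/-- The code of a global until with interval `[0, ∞)`. -/
def codeUntil (m n : ℕ) : ℕ :=
  Nat.pair 4 (Nat.pair (Nat.pair 0 Interval.univ.code) (Nat.pair m n))

theorem code_untl (φ ψ : Formula k) :
    (Formula.untl .glob .univ φ ψ).code = codeUntil φ.code ψ.code := by
  simp only [Formula.code, FDir.code, codeUntil]

theorem codeUntil_primrec : Primrec₂ codeUntil := by
  unfold codeUntil
  exact Primrec₂.natPair.comp (Primrec.const _) (Primrec₂.natPair.comp (Primrec.const _)
    (Primrec₂.natPair.comp Primrec.fst Primrec.snd))

/-- Only `rowTail` depends on `n`, through a fold over the input symbols; all other subformulas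
contribute constants, so the noncomputable choices in `anyOf` are harmless. -/
theorem haltingFormula_code_primrec {input : ℕ → List Γ}
    (h : ∀ f : Γ → ℕ, Primrec fun n => (input n).map f) :
    Primrec fun n => (haltingFormula e M (input n)).code := by
  let g : Γ → ℕ := fun a => (callLetter e ruleLhs (cell a)).code
  have key : ∀ (B Q : ConfLetter Γ Λ) (n : ℕ), codeAnd (Formula.and (frame e)
      (tiling e ruleLhs (ruleRhs M) none (state none))).code
      (codeUntil (callLetter e ruleLhs B).code
        (codeAnd (callLetter e ruleLhs Q).code (((input n).map g).foldr
          (fun s c => codeUntil (Formula.bot (k := k)).code (codeAnd s c))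
          (codeUntil (callLetter e ruleLhs B).code (Formula.neg (.atom .call) : Formula k).code)))) =
      (Formula.and (Formula.and (frame e) (tiling e ruleLhs (ruleRhs M) none (state none)))
        (firstRow e ruleLhs B Q ((input n).map cell))).code := by
    intro B Q n
    have htail : (((input n).map g).foldr
          (fun s c => codeUntil (Formula.bot (k := k)).code (codeAnd s c))
          (codeUntil (callLetter e ruleLhs B).code
            (Formula.neg (.atom .call) : Formula k).code)) =
        (rowTail e ruleLhs B ((input n).map cell)).code := by
      induction input n with
      | nil => simp only [rowTail, List.map_nil, List.foldr_nil, code_untl]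
      | cons a x ih =>
        have h1 : rowTail e ruleLhs B ((a :: x).map cell) = .untl .glob .univ .bot
          ((callLetter e ruleLhs (cell a)).and (rowTail e ruleLhs B (x.map cell))) := rfl
        rw [List.map_cons, List.foldr_cons, ih, h1, code_untl, code_and]
    simp only [htail, firstRow, code_and, code_untl]
  refine Primrec.of_eq ?_ (key _ _)
  refine codeAnd_primrec.comp (Primrec.const _) (codeUntil_primrec.comp (Primrec.const _)
    (codeAnd_primrec.comp (Primrec.const _) ?_))
  refine Primrec.list_foldr (h := fun _ p => codeUntil (Formula.bot (k := k)).code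
    (codeAnd p.1 p.2)) (h g) (Primrec.const _) ?_
  exact codeUntil_primrec.comp (Primrec.const _)
    (codeAnd_primrec.comp (Primrec.fst.comp Primrec.snd) (Primrec.snd.comp Primrec.snd))

end Reduction

theorem not_satisfiabilityDecidable_isFutureAbsNext :
    ¬ SatisfiabilityDecidable (fun _ φ => φ.IsFutureAbsNext) := by
  rintro ⟨f, hf, hfspec⟩
  obtain ⟨Γ, Λ, _, _, _, _, M, input, hinput, hundec⟩ := exists_universal_machine
  -- One proposition per tile: `k` depends on the machine alone, so the reduction uses a constant
  -- `k`.
  obtain ⟨k, ⟨e⟩⟩ := Finite.exists_equiv_fin (Tile (ConfLetter Γ Λ) (Γ × Λ × Γ))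
  refine hundec (ComputablePred.computable_iff.2
    ⟨fun n => f k (haltingFormula e M (input n)).code, ?_, ?_⟩)
  · exact hf.comp (Computable.const k) (haltingFormula_code_primrec e M hinput).to_comp
  · funext n
    exact propext ((haltingFormula_satisfiable_iff e M (input n)).symm.trans
      (hfspec k _ (haltingFormula_isFutureAbsNext e M (input n))).symm)

end NMTL

theorem mainTheorem2 :
    ¬ NMTL.SatisfiabilityDecidable (fun _ φ => φ.IsFuture) ∧
    ¬ NMTL.SatisfiabilityDecidable (fun _ φ => φ.IsFutureAbsNext) := by
  refine ⟨?_, NMTL.not_satisfiabilityDecidable_isFutureAbsNext⟩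
  rintro ⟨f, hf, hfspec⟩
  exact NMTL.not_satisfiabilityDecidable_isFutureAbsNext
    ⟨f, hf, fun k φ hφ => hfspec k φ hφ.isFuture⟩
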